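/- **Setting.** Fix $d\ge 1$, exponents $1<p<q<\infty$ with $q'=q/(q-1)$, and $0<\gamma<1$. Let $B_1,B_2$ be (real or complex) Banach spaces with $B_2$ reflexive. *Operators.* For a Banach space $B$ let $\mathrm S_B$ be the space of $B$-valued simple functions $\sum_{i=1}^N a_i\mathbb 1_{E_i}$ on $\mathbb R^d$, with $E_i$ Lebesgue measurable and contained in a compact set. $\mathrm{Op}_{B_1,B_2}$ is the space of linear operators $T$ mapping functions in $\mathrm S_{B_1}$ to weakly measurable $B_2$-valued functions such that $x\mapsto\langle Tf(x),\lambda\rangle$ is locally integrable for all $f\in \mathrm S_{B_1}$, $\lambda\in B_2^*$. For $f_1\in\mathrm S_{B_1}$, $f_2\in \mathrm S_{B_2^*}$ put $\langle Tf_1,f_2\rangle=\int\langle Tf_1(x),f_2(x)\rangle\,dx$. Let $\mathrm{Dil}_tf(x)=f(tx)$ and $\mathrm{Dil}_tT=\mathrm{Dil}_t\circ T\circ \mathrm{Dil}_{t^{-1}}$. *Sparse forms.* Let $\mathfrak Q$ be a dyadic lattice of (half-open) cubes in the sense of Lerner and Nazarov: every dyadic child of a cube in $\mathfrak Q$ is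 in $\mathfrak Q$, any two cubes in $\mathfrak Q$ have a common dyadic ancestor in $\mathfrak Q$, and every compact set is contained in a cube of $\mathfrak Q$. A collection $\mathfrak S\subset\mathfrak Q$ is $\gamma$-sparse if there are pairwise disjoint measurable sets $E_Q\subset Q$ $(Q\in\mathfrak S)$ with $|E_Q|\ge\gamma|Q|$. Put $$\Lambda^*_{p,B_1,q',B_2^*}(f_1,f_2)=\sup_{\mathfrak S\subset \mathfrak Q\ \gamma\text{-sparse}}\ \sum_{Q\in\mathfrak S}|Q|\Big(\frac1{|Q|}\int_Q|f_1|_{B_1}^p\Big)^{1/p}\Big(\frac1{|Q|}\int_Q|f_2|_{B_2^*}^{q'}\Big)^{1/q'}.$$ *Norms.* For $1<p<\infty$, $L^{p,\infty}_B$ and $L^{p,1}_B$ are the Lorentz spaces of strongly measurable functions $f$, with norms $\sup_{t>0}t^{1/p}f^{**}(t)$ and $\frac1p\int_0^\infty t^{1/p}f^{**}(t)\frac{dt}t$, where $f^{**}(t)=\frac1t\int_0^tf^*$ and $f^*$ is the nonincreasing rearrangement of $|f|_B$. For an operator $T\in \mathrm{Op}_{B_1,B_2}$, the inequality $\|T\|_{X\to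 Y}\le A$ means that for every $f\in \mathrm S_{B_1}$ there is a strongly measurable $g:\mathbb R^d\to B_2$, with $\langle Tf(x),\lambda\rangle=\langle g(x),\lambda\rangle$ for a.e. $x$ for each $\lambda\in B_2^*$, such that $\|g\|_Y\le A\|f\|_X$. *Support conditions.* Supports are complements of the largest open sets on which a function vanishes almost everywhere (for $B_2$-valued weakly measurable functions: after pairing with each $\lambda\in B_2^*$), and $\mathrm{dist}(x,\emptyset)=\infty$. A family $\{T_j\}_{j\in\mathbb Z}\subset \mathrm{Op}_{B_1,B_2}$ satisfies the support condition if for all $j\in\mathbb Z$ and $f\in \mathrm S_{B_1}$ $$\mathrm{supp}\,\big((\mathrm{Dil}_{2^j}T_j)f\big)\subset\{x:\mathrm{dist}(x,\mathrm{supp} f)\le1\}.$$ It satisfies the strengthened support condition with parameters $\delta_1>\delta_2>0$ if for all $j\in\mathbb Z$ and all $f\in \mathrm S_{B_1}$ with $\mathrm{diam}(\mathrm{supp} f)\le\delta_2$ $$\mathrm{supp}\,\big((\mathrm{Dil}_{2^j}T_j)f\big)\subset\{x:\delta_1\le\mathrm{dist}(x,\mathrm{supp} f)\le1\}.$$ **Theorem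 2.5.** Let $\{T_j\}_{j\in\mathbb Z}$ be a family of operators in $\mathrm{Op}_{B_1,B_2}$, with $B_2$ reflexive, that satisfies the support condition. Assume that there is $\mathscr C>0$ such that for all integers $N_1\le N_2$ and all $f_1\in \mathrm S_{B_1}$, $f_2\in \mathrm S_{B_2^*}$ $$\Big|\Big\langle\sum_{j=N_1}^{N_2}T_jf_1,f_2\Big\rangle\Big|\le\mathscr C\,\Lambda^*_{p,B_1,q',B_2^*}(f_1,f_2).$$ Then the following hold. (i) There is a constant $c>0$ depending only on $d,p,q,\gamma$ such that for all integers $N_1\le N_2$ $$\Big\|\sum_{j=N_1}^{N_2}T_j\Big\|_{L^p_{B_1}\to L^{p,\infty}_{B_2}}\le c\,\mathscr C,\qquad \Big\|\sum_{j=N_1}^{N_2}T_j\Big\|_{L^{q,1}_{B_1}\to L^q_{B_2}}\le c\,\mathscr C.$$ (ii) If in addition the $T_j$ satisfy the strengthened support condition with parameters $\delta_1>\delta_2>0$, then there is a constant $c>0$ depending only on $d,p,q,\gamma,\delta_1,\delta_2$ such that $$\sup_{j\in\mathbb Z}\|\mathrm{Dil}_{2^j}T_j\|_{L^p_{B_1}\to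 L^q_{B_2}}\le c\,\mathscr C.$$ -/

import Mathlib

open MeasureTheory Set Filter Topology
open scoped ENNReal

noncomputable section

namespace SparseDom

/-- Euclidean space of dimension `d`, with the Euclidean norm and Lebesgue measure. -/
abbrev Rd (d : ℕ) : Type := EuclideanSpace ℝ (Fin d)

/-! ### Simple functions and operators -/

/-- The space of compactly supported simple functions with values in `B`: finitely many values,
each attained on a Lebesgue measurable set, vanishing outside a compact set. -/
def simpleSpace (d : ℕ) (𝕜 : Type*) [RCLike 𝕜] (B : Type*) [NormedAddCommGroup B]
    [NormedSpace 𝕜 B] : Submodule 𝕜 (Rd d → B) where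
  carrier := {f | (range f).Finite ∧ (∀ b : B, NullMeasurableSet (f ⁻¹' {b}) volume) ∧
    HasCompactSupport f}
  zero_mem' := by
    refine ⟨Set.finite_range_const (c := (0 : B)), fun b => ?_, HasCompactSupport.zero⟩
    have h : MeasurableSet ((fun _ : Rd d => (0 : B)) ⁻¹' {b}) := by
      by_cases hb : (0 : B) = b
      · simp [Set.preimage, hb]
      · simp [Set.preimage, hb]
    exact h.nullMeasurableSet
  add_mem' := by
    rintro f g ⟨hf, hf', hfc⟩ ⟨hg, hg', hgc⟩
    refine ⟨(hf.image2 (· + ·) hg).subset ?_, fun b => ?_, hfc.add hgc⟩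
    · rintro _ ⟨x, rfl⟩
      exact ⟨f x, ⟨x, rfl⟩, g x, ⟨x, rfl⟩, rfl⟩
    · have h : (f + g) ⁻¹' {b} = ⋃ a ∈ range f, f ⁻¹' {a} ∩ g ⁻¹' {b - a} := by
        ext x
        simp only [mem_preimage, mem_singleton_iff, Pi.add_apply, mem_iUnion, mem_inter_iff,
          exists_prop]
        constructor
        · rintro rfl
          exact ⟨f x, ⟨x, rfl⟩, rfl, by simp⟩
        · rintro ⟨a, -, rfl, h2⟩
          rw [h2, add_sub_cancel]
      rw [h]
      exact NullMeasurableSet.biUnion hf.countable fun a _ => (hf' a).inter (hg' _)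
  smul_mem' := by
    rintro c f ⟨hf, hf', hfc⟩
    refine ⟨(hf.image (c • ·)).subset ?_, fun b => ?_, hfc.smul_left (f := fun _ => c)⟩
    · rintro _ ⟨x, rfl⟩
      exact ⟨f x, ⟨x, rfl⟩, rfl⟩
    · have h : (c • f) ⁻¹' {b} = ⋃ a ∈ range f ∩ {a | c • a = b}, f ⁻¹' {a} := by
        ext x
        simp
      rw [h]
      exact NullMeasurableSet.biUnion (hf.countable.mono inter_subset_left) fun a _ => hf' a

section Operators

variable {d : ℕ} {𝕜 : Type*} [RCLike 𝕜]
  {B₁ : Type*} [NormedAddCommGroup B₁] [NormedSpace 𝕜 B₁]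
  {B₂ : Type*} [NormedAddCommGroup B₂] [NormedSpace 𝕜 B₂]

/-- The class `Op_{B₁,B₂}`: a linear operator `T` on simple functions belongs to it if every `T f`
is weakly measurable and weakly locally integrable. (`LocallyIntegrable` contains the Lebesgue
measurability of the scalar function.) -/
def IsOp (T : simpleSpace d 𝕜 B₁ →ₗ[𝕜] (Rd d → B₂)) : Prop :=
  ∀ (f : simpleSpace d 𝕜 B₁) (l : StrongDual 𝕜 B₂),
    LocallyIntegrable (fun x => l (T f x)) volume

/-- The bilinear pairing `⟨g, f₂⟩ = ∫ ⟨g(x), f₂(x)⟩ dx` of a `B₂`-valued and a `B₂^*`-valued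
function. -/
def pairing (g : Rd d → B₂) (f₂ : Rd d → StrongDual 𝕜 B₂) : 𝕜 :=
  ∫ x, f₂ x (g x)

/-- Two `B₂`-valued functions are weakly equal if they become equal almost everywhere after
pairing with any functional. Elements of `Op_{B₁,B₂}` are seen by the pairing only up to this
relation; for strongly measurable functions it is equality almost everywhere. -/
def WeakEq (𝕜 : Type*) [RCLike 𝕜] {B : Type*} [NormedAddCommGroup B] [NormedSpace 𝕜 B]
    (g h : Rd d → B) : Prop :=
  ∀ l : StrongDual 𝕜 B, ∀ᵐ x ∂(volume : Measure (Rd d)), l (g x) = l (h x)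

/-- `B` is reflexive. -/
def IsReflexive (𝕜 : Type*) [RCLike 𝕜] (B : Type*) [NormedAddCommGroup B] [NormedSpace 𝕜 B] :
    Prop :=
  Function.Surjective (NormedSpace.inclusionInDoubleDual 𝕜 B)

/-- `f(t ·)` is a simple function if `f` is, for `t ≠ 0`. -/
theorem comp_smul_mem (t : ℝ) (ht : t ≠ 0) (f : simpleSpace d 𝕜 B₁) :
    (fun x : Rd d => (f : Rd d → B₁) (t • x)) ∈ simpleSpace d 𝕜 B₁ := by
  obtain ⟨hf, hf', hfc⟩ := f.2
  refine ⟨hf.subset ?_, fun b => ?_, ?_⟩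
  · rintro _ ⟨x, rfl⟩
    exact ⟨t • x, rfl⟩
  · exact (hf' b).preimage (Measure.quasiMeasurePreserving_smul volume ht)
  · exact hfc.comp_homeomorph (Homeomorph.smulOfNeZero t ht)

/-- The dilation `Dil_t f = f(t ·)` on simple functions. -/
def dilSimple (t : ℝ) (ht : t ≠ 0) : simpleSpace d 𝕜 B₁ →ₗ[𝕜] simpleSpace d 𝕜 B₁ where
  toFun f := ⟨fun x => (f : Rd d → B₁) (t • x), comp_smul_mem t ht f⟩
  map_add' _ _ := rfl
  map_smul' _ _ := rfl

/-- The dilated operator `Dil_t T = Dil_t ∘ T ∘ Dil_{1/t}`. -/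
def dilOp (t : ℝ) (ht : t ≠ 0) (T : simpleSpace d 𝕜 B₁ →ₗ[𝕜] (Rd d → B₂)) :
    simpleSpace d 𝕜 B₁ →ₗ[𝕜] (Rd d → B₂) where
  toFun f := fun x => T (dilSimple t⁻¹ (inv_ne_zero ht) f) (t • x)
  map_add' _ _ := by ext x; simp
  map_smul' _ _ := by ext x; simp

/-- The operator `Dil_{2^j} T`. -/
def dyadicDil (j : ℤ) (T : simpleSpace d 𝕜 B₁ →ₗ[𝕜] (Rd d → B₂)) :
    simpleSpace d 𝕜 B₁ →ₗ[𝕜] (Rd d → B₂) :=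
  dilOp ((2 : ℝ) ^ j) (zpow_ne_zero j two_ne_zero) T

/-! ### Supports -/

/-- The (essential) support of a measurable function: the complement of the largest open set on
which it vanishes almost everywhere. -/
def essSupport {B : Type*} [Zero B] (f : Rd d → B) : Set (Rd d) :=
  {x | ∀ U ∈ 𝓝 x, ¬ ∀ᵐ y ∂(volume : Measure (Rd d)), y ∈ U → f y = 0}

/-- The support of a weakly measurable function: the complement of the largest open set on which
it is weakly equal to zero. -/
def weakSupport (𝕜 : Type*) [RCLike 𝕜] {B : Type*} [NormedAddCommGroup B] [NormedSpace 𝕜 B]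
    (g : Rd d → B) : Set (Rd d) :=
  {x | ∀ U ∈ 𝓝 x, ¬ ∀ l : StrongDual 𝕜 B,
    ∀ᵐ y ∂(volume : Measure (Rd d)), y ∈ U → l (g y) = 0}

/-- The support condition. (The distance to the empty set is `∞`.) -/
def SupportCondition (T : ℤ → simpleSpace d 𝕜 B₁ →ₗ[𝕜] (Rd d → B₂)) : Prop :=
  ∀ (j : ℤ) (f : simpleSpace d 𝕜 B₁),
    weakSupport 𝕜 (dyadicDil j (T j) f) ⊆
      {x | Metric.infEDist x (essSupport (f : Rd d → B₁)) ≤ 1}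

/-- The strengthened support condition with parameters `δ₁ > δ₂ > 0`. -/
def StrengthenedSupportCondition (δ₁ δ₂ : ℝ)
    (T : ℤ → simpleSpace d 𝕜 B₁ →ₗ[𝕜] (Rd d → B₂)) : Prop :=
  ∀ (j : ℤ) (f : simpleSpace d 𝕜 B₁),
    Metric.ediam (essSupport (f : Rd d → B₁)) ≤ ENNReal.ofReal δ₂ →
    weakSupport 𝕜 (dyadicDil j (T j) f) ⊆
      {x | ENNReal.ofReal δ₁ ≤ Metric.infEDist x (essSupport (f : Rd d → B₁)) ∧
        Metric.infEDist x (essSupport (f : Rd d → B₁)) ≤ 1}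

/-! ### Lorentz norms and operator bounds -/

/-- Nonincreasing rearrangement `f^*(t) = inf {s ≥ 0 : |{x : |f(x)| > s}| ≤ t}` of `|f|`. -/
def rearrangement {B : Type*} [NormedAddCommGroup B] (f : Rd d → B) (t : ℝ) : ℝ≥0∞ :=
  sInf {s : ℝ≥0∞ | volume {x : Rd d | s < ‖f x‖ₑ} ≤ ENNReal.ofReal t}

/-- The maximal function `f^{**}(t) = t⁻¹ ∫_0^t f^*(s) ds` of the rearrangement. -/
def maxRearrangement {B : Type*} [NormedAddCommGroup B] (f : Rd d → B) (t : ℝ) : ℝ≥0∞ :=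
  (ENNReal.ofReal t)⁻¹ * ∫⁻ s in Ioo 0 t, rearrangement f s

/-- The norm of `L^{p,∞}_B`, namely `sup_{t>0} t^{1/p} f^{**}(t)`. -/
def weakLorentzNorm {B : Type*} [NormedAddCommGroup B] (p : ℝ) (f : Rd d → B) : ℝ≥0∞ :=
  ⨆ t ∈ Ioi (0 : ℝ), ENNReal.ofReal (t ^ (1 / p)) * maxRearrangement f t

/-- The norm of `L^{p,1}_B`, namely `p⁻¹ ∫_0^∞ t^{1/p} f^{**}(t) dt/t`. -/
def lorentzOneNorm {B : Type*} [NormedAddCommGroup B] (p : ℝ) (f : Rd d → B) : ℝ≥0∞ :=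
  ENNReal.ofReal (1 / p) *
    ∫⁻ t in Ioi (0 : ℝ), ENNReal.ofReal (t ^ (1 / p - 1)) * maxRearrangement f t

/-- The norm of `L^p_B`. -/
def lebesgueNorm {B : Type*} [NormedAddCommGroup B] (p : ℝ) (f : Rd d → B) : ℝ≥0∞ :=
  eLpNorm f (ENNReal.ofReal p) volume

/-- `‖T‖_{X → Y} ≤ A` for an operator given on simple functions, where `X` and `Y` are the norms
of spaces of strongly measurable functions: each `T f` is identified with (is weakly equal to) a
strongly measurable function `g`, and `‖g‖_Y ≤ A ‖f‖_X`. -/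
def OpNormLE (T : simpleSpace d 𝕜 B₁ →ₗ[𝕜] (Rd d → B₂))
    (X : (Rd d → B₁) → ℝ≥0∞) (Y : (Rd d → B₂) → ℝ≥0∞) (A : ℝ) : Prop :=
  ∀ f : simpleSpace d 𝕜 B₁, ∃ g : Rd d → B₂,
    AEStronglyMeasurable g volume ∧ WeakEq 𝕜 (T f) g ∧
      Y g ≤ ENNReal.ofReal A * X (f : Rd d → B₁)

end Operators

/-! ### Dyadic lattices and sparse forms -/

/-- A half-open axis-parallel cube, given by its lower corner and its side length. -/
structure Cube (d : ℕ) where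
  corner : Fin d → ℝ
  side : ℝ
  side_pos : 0 < side

namespace Cube

variable {d : ℕ}

/-- The point set of a cube. -/
def toSet (Q : Cube d) : Set (Rd d) :=
  {x | ∀ i, x i ∈ Ico (Q.corner i) (Q.corner i + Q.side)}

/-- `R ∈ 𝒟_l(Q)`: `R` is one of the `2^{ld}` dyadic subcubes of `Q` whose side length is `2^{-l}`
times that of `Q`. -/
def IsDyadicSubcube (l : ℕ) (R Q : Cube d) : Prop :=
  R.side = Q.side / 2 ^ l ∧
    ∀ i, ∃ k : ℕ, k < 2 ^ l ∧ R.corner i = Q.corner i + k * (Q.side / 2 ^ l)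

end Cube

/-- Dyadic lattices in the sense of Lerner and Nazarov. -/
structure IsDyadicLattice {d : ℕ} (L : Set (Cube d)) : Prop where
  children : ∀ Q ∈ L, ∀ R : Cube d, R.IsDyadicSubcube 1 Q → R ∈ L
  ancestor : ∀ Q ∈ L, ∀ Q' ∈ L, ∃ P ∈ L,
    (∃ l, Q.IsDyadicSubcube l P) ∧ (∃ l, Q'.IsDyadicSubcube l P)
  compact : ∀ K : Set (Rd d), IsCompact K → ∃ Q ∈ L, K ⊆ Q.toSet

/-- `γ`-sparse collections of cubes. -/
def IsSparse {d : ℕ} (γ : ℝ) (S : Set (Cube d)) : Prop :=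
  ∃ E : Cube d → Set (Rd d),
    (∀ Q ∈ S, NullMeasurableSet (E Q) volume ∧ E Q ⊆ Q.toSet ∧
      ENNReal.ofReal γ * volume Q.toSet ≤ volume (E Q)) ∧
    S.PairwiseDisjoint E

/-- The normalized average `⟨f⟩_{Q,p,B} = (|Q|⁻¹ ∫_Q |f|_B^p)^{1/p}`. -/
def cubeAvg {d : ℕ} {B : Type*} [NormedAddCommGroup B] (p : ℝ) (Q : Cube d) (f : Rd d → B) :
    ℝ≥0∞ :=
  ((volume Q.toSet)⁻¹ * ∫⁻ x in Q.toSet, ‖f x‖ₑ ^ p) ^ (1 / p)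

/-- The sparse form `∑_{Q ∈ S} |Q| ⟨f₁⟩_{Q,p₁} ⟨f₂⟩_{Q,p₂}`. -/
def sparseForm {d : ℕ} {B C : Type*} [NormedAddCommGroup B] [NormedAddCommGroup C]
    (S : Set (Cube d)) (p₁ p₂ : ℝ) (f₁ : Rd d → B) (f₂ : Rd d → C) : ℝ≥0∞ :=
  ∑' Q : S, volume (Q : Cube d).toSet * cubeAvg p₁ (Q : Cube d) f₁ * cubeAvg p₂ (Q : Cube d) f₂

/-- The maximal form: the supremum of the sparse forms over all `γ`-sparse subcollections of the
dyadic lattice `L`. -/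
def maximalForm {d : ℕ} {B C : Type*} [NormedAddCommGroup B] [NormedAddCommGroup C]
    (L : Set (Cube d)) (γ p₁ p₂ : ℝ) (f₁ : Rd d → B) (f₂ : Rd d → C) : ℝ≥0∞ :=
  ⨆ (S : Set (Cube d)) (_ : S ⊆ L) (_ : IsSparse γ S), sparseForm S p₁ p₂ f₁ f₂

/-- The sparse bound `|⟨T f₁, f₂⟩| ≤ A Λ^*_{p₁,B₁,p₂,B₂^*}(f₁, f₂)` for all simple `f₁`, `f₂`. -/
def SparseBound {d : ℕ} {𝕜 : Type*} [RCLike 𝕜]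
    {B₁ : Type*} [NormedAddCommGroup B₁] [NormedSpace 𝕜 B₁]
    {B₂ : Type*} [NormedAddCommGroup B₂] [NormedSpace 𝕜 B₂]
    (L : Set (Cube d)) (γ p₁ p₂ A : ℝ) (T : simpleSpace d 𝕜 B₁ →ₗ[𝕜] (Rd d → B₂)) : Prop :=
  ∀ (f₁ : simpleSpace d 𝕜 B₁) (f₂ : simpleSpace d 𝕜 (StrongDual 𝕜 B₂)),
    ‖pairing (T f₁) (f₂ : Rd d → StrongDual 𝕜 B₂)‖ₑ ≤
      ENNReal.ofReal A *
        maximalForm L γ p₁ p₂ (f₁ : Rd d → B₁) (f₂ : Rd d → StrongDual 𝕜 B₂)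

end SparseDom

end

open SparseDom

/-!
The sparse bound is a bilinear estimate, so it controls pairings `⟨T f, f₂⟩`, while the claim is about
norms of a strongly measurable representative of `T f`. The two are linked by
`exists_strong_representative`: since `B₂` is reflexive and the pairings are locally bounded, the
averages of `T f` over balls are vectors of `B₂`. They span a separable closed subspace, and weak
cluster points of the averages over small balls define, by Lebesgue differentiation, a function `g`
which is weakly equal to `T f` and strongly measurable. Choosing pointwise almost norming functionals
shows that `∫ φ ‖g‖` is at most the supremum of `|⟨T f, f₂⟩|` over simple `f₂` with `‖f₂‖ ≤ φ`. Norm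
bounds for `g` therefore follow from scalar duality (`weakLorentzNorm_le`,
`lintegral_rpow_le_of_simple`).

For the endpoint bounds, a sparse collection satisfies the weak-type estimates of the dyadic maximal
operator with respect to the weights `|Q|` (`IsSparse.sum_volume_le_lintegral`). Two layer cake
arguments turn these into the restricted bound
`Λ*(f₁, f₂) ≲ ‖f₁‖_p |E| ^ (1 - 1 / p)` for `‖f₂‖ ≤ 1_E`
(`maximalForm_le_of_le_indicator`); it needs `q' (1 - 1 / p) < 1`, that is `p < q`. This gives
`L^p → L^{p,∞}`. With the roles of the two functions exchanged it gives `L^{q,1} → L^q`, after a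
decomposition of `f₁` into dyadic layers.

For a single operator under the strengthened support condition, `f₁` is cut into pieces of diameter
at most `δ₂`, and `f₂` may be restricted to points at distance between `δ₁` and `1` from the support of
each piece. The cubes that meet both supports are then not small, and since `1 / p + 1 / q' > 1` the
sparse sum over large cubes near a given ball converges (`exists_maximalForm_le_of_separated`). The
powers of `2 ^ j` produced by the dilation cancel.
-/

namespace SparseDom

/-! ### Functional analysis: norming sequences and weak limits -/

section Banach

variable {𝕜 : Type*} [RCLike 𝕜] {B : Type*} [NormedAddCommGroup B] [NormedSpace 𝕜 B]

/-- On a separable subspace the norm is the supremum of the real parts of countably many functionals of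
norm at most one. The normalization `Λ 0 = 0` makes the supremum of the real parts nonnegative on all
of `B`. -/
theorem exists_norming_seq (V : Submodule 𝕜 B) (hV : TopologicalSpace.IsSeparable (V : Set B)) :
    ∃ Λ : ℕ → StrongDual 𝕜 B, Λ 0 = 0 ∧ (∀ k, ‖Λ k‖ ≤ 1) ∧
      ∀ b ∈ V, ‖b‖ₑ = ⨆ k, ENNReal.ofReal (RCLike.re (Λ k b)) := by
  obtain ⟨c, hc, hVc⟩ := hV
  have hne : c.Nonempty := by
    rw [← closure_nonempty_iff]
    exact ⟨0, hVc V.zero_mem⟩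
  obtain ⟨u, rfl⟩ := hc.exists_eq_range hne
  choose l hl1 hl2 using fun k => exists_dual_vector'' 𝕜 (u k)
  refine ⟨fun k => Nat.casesOn k 0 l, rfl, ?_, fun b hb => le_antisymm ?_ ?_⟩
  · rintro (_ | k)
    · simp
    · exact hl1 k
  · refine ENNReal.le_of_forall_pos_le_add fun ε hε _ => ?_
    have hε' : (0 : ℝ) < ε / 2 := by positivity
    obtain ⟨_, ⟨k, rfl⟩, hk⟩ := Metric.mem_closure_iff.1 (hVc hb) (ε / 2) hε'
    have h1 : ‖b‖ ≤ RCLike.re (l k b) + ε := by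
      have e1 : ‖b‖ ≤ ‖u k‖ + ‖b - u k‖ := by
        simpa using norm_add_le (u k) (b - u k)
      have e2 : ‖u k‖ = RCLike.re (l k (u k)) := by rw [hl2]; simp
      have e3 : RCLike.re (l k (u k)) = RCLike.re (l k b) - RCLike.re (l k (b - u k)) := by
        simp
      have e4 : -RCLike.re (l k (b - u k)) ≤ ‖b - u k‖ := by
        refine (neg_le_abs _).trans ((RCLike.abs_re_le_norm _).trans ?_)
        simpa using (l k).le_of_opNorm_le (hl1 k) (b - u k)
      rw [dist_eq_norm] at hk
      linarith
    calc ‖b‖ₑ = ENNReal.ofReal ‖b‖ := (ofReal_norm b).symm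
      _ ≤ ENNReal.ofReal (RCLike.re (l k b) + ε) := ENNReal.ofReal_le_ofReal h1
      _ ≤ ENNReal.ofReal (RCLike.re (l k b)) + ENNReal.ofReal ε := ENNReal.ofReal_add_le
      _ ≤ _ := by
        rw [ENNReal.ofReal_coe_nnreal]
        gcongr
        exact le_iSup (fun k => ENNReal.ofReal
          (RCLike.re ((Nat.casesOn k 0 l : StrongDual 𝕜 B) b))) (k + 1)
  · refine iSup_le fun k => ?_
    rw [← ofReal_norm b]
    apply ENNReal.ofReal_le_ofReal
    rcases k with _ | k
    · simp
    · refine (RCLike.re_le_norm _).trans ?_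
      simpa using (l k).le_of_opNorm_le (hl1 k) b

theorem exists_dual_separating (V : Submodule 𝕜 B) (hV : IsClosed (V : Set B)) {b : B}
    (hb : b ∉ V) : ∃ l : StrongDual 𝕜 B, l b ≠ 0 ∧ ∀ v ∈ V, l v = 0 := by
  have := hV
  have h : ‖V.mkQL b‖ ≠ 0 := by
    rw [norm_ne_zero_iff]
    simpa using hb
  obtain ⟨m, -, hm⟩ := exists_dual_vector 𝕜 (V.mkQL b) h
  refine ⟨m.comp V.mkQL, ?_, fun v hv => ?_⟩
  · rw [ContinuousLinearMap.comp_apply, hm]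
    exact_mod_cast h
  · have : V.mkQL v = 0 := by simpa using hv
    rw [ContinuousLinearMap.comp_apply, this, map_zero]

/-- In a reflexive space every bounded sequence has a weak cluster point (Banach–Alaoglu). -/
theorem IsReflexive.exists_weak_cluster (hB : IsReflexive 𝕜 B) (a : ℕ → B) (M : ℝ)
    (ha : ∀ᶠ n in atTop, ‖a n‖ ≤ M) :
    ∃ b : B, ∀ (l : StrongDual 𝕜 B) (z : 𝕜), Tendsto (fun n => l (a n)) atTop (𝓝 z) → l b = z := by
  let ι : B → WeakDual 𝕜 (StrongDual 𝕜 B) := fun b =>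
    StrongDual.toWeakDual (NormedSpace.inclusionInDoubleDual 𝕜 B b)
  have hc := WeakDual.isCompact_closedBall (𝕜 := 𝕜) (E := StrongDual 𝕜 B) 0 M
  obtain ⟨y, -, hy⟩ := hc.ultrafilter_le_nhds ((hyperfilter ℕ).map (ι ∘ a)) (by
    rw [le_principal_iff]
    refine Filter.mem_map.2 (Nat.hyperfilter_le_atTop ?_)
    filter_upwards [ha] with n hn
    simp only [mem_preimage, Function.comp_apply, Metric.mem_closedBall, dist_zero_right]
    exact (NormedSpace.double_dual_bound 𝕜 B (a n)).trans hn)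
  obtain ⟨b, hb⟩ := hB (WeakDual.toStrongDual y)
  refine ⟨b, fun l z hz => ?_⟩
  have h1 : Tendsto (fun n => ι (a n) l) (hyperfilter ℕ) (𝓝 (y l)) :=
    ((WeakDual.eval_continuous l).tendsto y).comp (show Tendsto (ι ∘ a) (hyperfilter ℕ) (𝓝 y) from hy)
  have h2 : l b = y l := by
    rw [← NormedSpace.dual_def 𝕜 B b l, hb]; rfl
  rw [h2]
  exact tendsto_nhds_unique h1 (hz.mono_left Nat.hyperfilter_le_atTop)

/-- A weakly measurable function with values in a closed separable subspace is almost everywhere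
strongly measurable: the countably many functionals of a norming sequence embed the subspace
measurably into a sequence space. -/
theorem aestronglyMeasurable_of_mem {α : Type*} [MeasurableSpace α] {μ : Measure α}
    [CompleteSpace B] (V : Submodule 𝕜 B) (hVc : IsClosed (V : Set B))
    (hV : TopologicalSpace.IsSeparable (V : Set B)) (g : α → B) (hg : ∀ x, g x ∈ V)
    (hm : ∀ l : StrongDual 𝕜 B, AEMeasurable (fun x => RCLike.re (l (g x))) μ) :
    AEStronglyMeasurable g μ := by
  obtain ⟨Λ, -, -, hΛ⟩ := exists_norming_seq V hV
  have : CompleteSpace V := hVc.completeSpace_coe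
  have : TopologicalSpace.SeparableSpace V := hV.separableSpace
  have : SecondCountableTopology V := UniformSpace.secondCountable_of_separable V
  let : MeasurableSpace V := borel V
  have : BorelSpace V := ⟨rfl⟩
  let e : V → (ℕ → ℝ) := fun b k => RCLike.re (Λ k (b : B))
  have hec : Continuous e := by
    refine continuous_pi fun k => ?_
    exact RCLike.continuous_re.comp ((Λ k).continuous.comp continuous_subtype_val)
  have hei : Function.Injective e := by
    intro b b' h
    have h0 : ‖(b : B) - b'‖ₑ = 0 := by
      rw [hΛ _ (V.sub_mem b.2 b'.2)]
      simp only [ENNReal.iSup_eq_zero, map_sub]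
      intro k
      have := congrFun h k
      simp only [e] at this
      rw [this]; simp
    rw [enorm_eq_zero, sub_eq_zero] at h0
    exact Subtype.ext h0
  have hme := hec.measurableEmbedding hei
  let g' : α → V := fun x => ⟨g x, hg x⟩
  have h1 : AEMeasurable g' μ := by
    rw [← hme.aemeasurable_comp_iff]
    exact aemeasurable_pi_iff.2 fun k => hm (Λ k)
  exact continuous_subtype_val.comp_aestronglyMeasurable h1.aestronglyMeasurable

end Banach

/-! ### Simple functions and the pairing -/

section Simple

variable {d : ℕ} {𝕜 : Type*} [RCLike 𝕜]
  {B : Type*} [NormedAddCommGroup B] [NormedSpace 𝕜 B]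

theorem aestronglyMeasurable_of_mem_simpleSpace {f : Rd d → B} (hf : f ∈ simpleSpace d 𝕜 B) :
    AEStronglyMeasurable f volume := by
  obtain ⟨h1, h2, -⟩ := hf
  have h : f = fun x => ∑ b ∈ h1.toFinset, (f ⁻¹' {b}).indicator (fun _ => b) x := by
    ext x
    rw [Finset.sum_eq_single (f x)]
    · simp
    · intro b _ hb
      rw [indicator_of_notMem]
      simpa using hb.symm
    · intro h; simp at h
  rw [h]
  exact Finset.aestronglyMeasurable_fun_sum _ fun b _ =>
    aestronglyMeasurable_const.indicator₀ (h2 b)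

/-- Restricting a simple function to a measurable set gives a simple function. -/
theorem indicator_mem_simpleSpace {f : Rd d → B} (hf : f ∈ simpleSpace d 𝕜 B) {s : Set (Rd d)}
    (hs : NullMeasurableSet s volume) : s.indicator f ∈ simpleSpace d 𝕜 B := by
  classical
  obtain ⟨h1, h2, h3⟩ := hf
  refine ⟨(h1.union (finite_singleton 0)).subset ?_, fun b => ?_, ?_⟩
  · rintro _ ⟨x, rfl⟩
    by_cases hx : x ∈ s
    · left; simp [hx]
    · right; simp [hx]
  · rw [indicator_preimage]
    have h0 : NullMeasurableSet ((0 : Rd d → B) ⁻¹' {b}) volume := (0 : simpleSpace d 𝕜 B).2.2.1 b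
    exact ((h2 b).inter hs).union (h0.diff hs)
  · refine h3.mono ?_
    intro x hx
    simp only [Function.mem_support, ne_eq, indicator_apply_eq_zero, Classical.not_imp] at hx
    exact hx.2

theorem indicator_const_mem_simpleSpace {s : Set (Rd d)} (hs : NullMeasurableSet s volume)
    {K : Set (Rd d)} (hK : IsCompact K) (hsK : s ⊆ K) (b : B) :
    s.indicator (fun _ => b) ∈ simpleSpace d 𝕜 B := by
  refine ⟨(toFinite {b, 0}).subset ?_, fun c => ?_, ?_⟩
  · rintro _ ⟨x, rfl⟩
    by_cases hx : x ∈ s <;> simp [hx]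
  · have h0 : NullMeasurableSet ((0 : Rd d → B) ⁻¹' {c}) volume := (0 : simpleSpace d 𝕜 B).2.2.1 c
    rw [indicator_preimage]
    refine NullMeasurableSet.union (NullMeasurableSet.inter ?_ hs) (h0.diff hs)
    by_cases hb : b = c
    · simp [hb, preimage]
    · simp [hb, preimage]
  · refine HasCompactSupport.intro hK fun x hx => ?_
    exact indicator_of_notMem (fun h => hx (hsK h)) _

/-- The integral defining `pairing` converges, so `pairing` takes no junk value on such functions. -/
theorem integrable_pairing {F : Rd d → B} (hF : ∀ l : StrongDual 𝕜 B,
    LocallyIntegrable (fun x => l (F x)) volume) (f : simpleSpace d 𝕜 (StrongDual 𝕜 B)) :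
    Integrable (fun x => (f : Rd d → StrongDual 𝕜 B) x (F x)) volume := by
  obtain ⟨h1, h2, h3⟩ := f.2
  set f' := (f : Rd d → StrongDual 𝕜 B)
  have h : (fun x => f' x (F x)) =
      fun x => ∑ l ∈ h1.toFinset, (f' ⁻¹' {l}).indicator (fun x => l (F x)) x := by
    ext x
    rw [Finset.sum_eq_single (f' x)]
    · simp
    · intro b _ hb
      rw [indicator_of_notMem]
      simpa using hb.symm
    · intro h; simp at h
  rw [h]
  refine integrable_finsetSum _ fun l _ => ?_
  by_cases hl : l = 0
  · simp [hl]
  · refine IntegrableOn.integrable_indicator₀ ?_ (h2 l)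
    refine ((hF l).integrableOn_isCompact h3).mono_set ?_
    rintro x hx
    refine subset_tsupport _ ?_
    simp only [mem_preimage, mem_singleton_iff] at hx
    simpa [hx] using hl

end Simple

/-! ### Strongly measurable representatives -/

section Representative

variable {d : ℕ} {𝕜 : Type*} [RCLike 𝕜]
  {B : Type*} [NormedAddCommGroup B] [NormedSpace 𝕜 B]

/-- Measurable selection of an index at which the maximum of finitely many functions is attained. -/
theorem exists_argmax {α : Type*} [MeasurableSpace α] {μ : Measure α} (G : ℕ → α → ℝ)
    (hG : ∀ k, AEMeasurable (G k) μ) (m : ℕ) :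
    ∃ κ : α → ℕ, (∀ x, κ x ≤ m) ∧ (∀ x, ∀ k ≤ m, G k x ≤ G (κ x) x) ∧
      ∀ j, NullMeasurableSet (κ ⁻¹' {j}) μ := by
  classical
  have hex : ∀ x, ∃ j, j ≤ m ∧ ∀ k ≤ m, G k x ≤ G j x := by
    intro x
    obtain ⟨j, hj, hj'⟩ := Finset.exists_max_image (Finset.range (m + 1)) (fun k => G k x) ⟨0, by simp⟩
    refine ⟨j, by simpa [Nat.lt_succ_iff] using hj, fun k hk => hj' k (by simpa [Nat.lt_succ_iff])⟩
  have hA : ∀ j, NullMeasurableSet {x | j ≤ m ∧ ∀ k ≤ m, G k x ≤ G j x} μ := by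
    intro j
    by_cases hj : j ≤ m
    · have : {x | j ≤ m ∧ ∀ k ≤ m, G k x ≤ G j x} = ⋂ k ∈ Iic m, {x | G k x ≤ G j x} := by
        ext x; simp [hj]
      rw [this]
      exact NullMeasurableSet.biInter (to_countable _) fun k _ => nullMeasurableSet_le (hG k) (hG j)
    · simp [hj]
  refine ⟨fun x => Nat.find (hex x), fun x => (Nat.find_spec (hex x)).1,
    fun x => (Nat.find_spec (hex x)).2, fun j => ?_⟩
  have : (fun x => Nat.find (hex x)) ⁻¹' {j} = {x | j ≤ m ∧ ∀ k ≤ m, G k x ≤ G j x} \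
      ⋃ i ∈ Iio j, {x | i ≤ m ∧ ∀ k ≤ m, G k x ≤ G i x} := by
    ext x
    simp only [mem_preimage, mem_singleton_iff, Nat.find_eq_iff, Set.mem_sdiff, mem_ofPred_eq, mem_iUnion,
      mem_Iio, exists_prop, not_exists, not_and]
  rw [this]
  exact (hA j).diff (NullMeasurableSet.biUnion (to_countable _) fun i _ => hA i)

/-- If all pairings of `F` with simple functions bounded by `φ` are at most `K`, then the supremum of
countably many real parts `Re ⟨F, Λ k⟩` with `‖Λ k‖ ≤ 1` has integral at most `K` against `φ`. -/
theorem lintegral_iSup_re_le {F : Rd d → B} (hF : ∀ l : StrongDual 𝕜 B,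
    LocallyIntegrable (fun x => l (F x)) volume) (Λ : ℕ → StrongDual 𝕜 B) (hΛ0 : Λ 0 = 0)
    (hΛ : ∀ k, ‖Λ k‖ ≤ 1) (φ : simpleSpace d ℝ ℝ) (hφ : ∀ x, 0 ≤ (φ : Rd d → ℝ) x) (K : ℝ≥0∞)
    (hK : ∀ f : simpleSpace d 𝕜 (StrongDual 𝕜 B),
      (∀ x, ‖(f : Rd d → StrongDual 𝕜 B) x‖ ≤ (φ : Rd d → ℝ) x) → ‖pairing F f.1‖ₑ ≤ K) :
    ∫⁻ x, ENNReal.ofReal ((φ : Rd d → ℝ) x) * ⨆ k, ENNReal.ofReal (RCLike.re (Λ k (F x))) ≤ K := by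
  have hG : ∀ k, AEMeasurable (fun x => RCLike.re (Λ k (F x))) volume := fun k =>
    RCLike.continuous_re.measurable.comp_aemeasurable (hF (Λ k)).aestronglyMeasurable.aemeasurable
  have hφm : AEMeasurable (φ : Rd d → ℝ) volume :=
    (aestronglyMeasurable_of_mem_simpleSpace φ.2).aemeasurable
  have hfin : ∀ m : ℕ, ∫⁻ x, ENNReal.ofReal ((φ : Rd d → ℝ) x) *
      ⨆ k, ⨆ _ : k ≤ m, ENNReal.ofReal (RCLike.re (Λ k (F x))) ≤ K := by
    intro m
    obtain ⟨κ, hκm, hκ, hκn⟩ := exists_argmax (fun k x => RCLike.re (Λ k (F x))) hG m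
    let f' : Rd d → StrongDual 𝕜 B := fun x => (((φ : Rd d → ℝ) x : ℝ) : 𝕜) • Λ (κ x)
    have hf' : f' ∈ simpleSpace d 𝕜 (StrongDual 𝕜 B) := by
      obtain ⟨h1, h2, h3⟩ := φ.2
      refine ⟨(h1.image2 (fun r j => ((r : ℝ) : 𝕜) • Λ j) (finite_Iic m)).subset ?_, fun b => ?_, ?_⟩
      · rintro _ ⟨x, rfl⟩
        exact ⟨_, ⟨x, rfl⟩, κ x, hκm x, rfl⟩
      · have : f' ⁻¹' {b} = ⋃ p ∈ (range (φ : Rd d → ℝ) ×ˢ Iic m) ∩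
            {p : ℝ × ℕ | ((p.1 : ℝ) : 𝕜) • Λ p.2 = b},
            (φ : Rd d → ℝ) ⁻¹' {p.1} ∩ κ ⁻¹' {p.2} := by
          ext x
          simp only [mem_preimage, mem_singleton_iff, mem_iUnion, exists_prop]
          constructor
          · intro h
            exact ⟨((φ : Rd d → ℝ) x, κ x), ⟨⟨⟨x, rfl⟩, hκm x⟩, h⟩, rfl, rfl⟩
          · rintro ⟨p, ⟨-, hp⟩, h1, h2⟩
            simp only [mem_preimage, mem_singleton_iff] at h1 h2
            simp only [f', h1, h2]
            exact hp
        rw [this]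
        exact NullMeasurableSet.biUnion
          (((h1.prod (finite_Iic m)).countable).mono inter_subset_left)
          fun p _ => (h2 _).inter (hκn _)
      · refine h3.mono fun x hx => ?_
        rw [Function.mem_support] at hx ⊢
        intro h
        exact hx (by simp only [f', h, RCLike.ofReal_zero]; exact zero_smul 𝕜 (Λ (κ x)))
    have hb := hK ⟨f', hf'⟩ (fun x => by
      simp only [f']
      rw [norm_smul, RCLike.norm_ofReal, abs_of_nonneg (hφ x)]
      exact mul_le_of_le_one_right (hφ x) (hΛ _))
    have hint := integrable_pairing hF ⟨f', hf'⟩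
    simp only at hint
    have hre : ∀ x, RCLike.re (f' x (F x)) = (φ : Rd d → ℝ) x * RCLike.re (Λ (κ x) (F x)) := by
      intro x
      simp [f']
    have hpos : ∀ x, 0 ≤ RCLike.re (Λ (κ x) (F x)) := by
      intro x
      have := hκ x 0 (Nat.zero_le m)
      simpa [hΛ0] using this
    calc ∫⁻ x, ENNReal.ofReal ((φ : Rd d → ℝ) x) *
        ⨆ k, ⨆ _ : k ≤ m, ENNReal.ofReal (RCLike.re (Λ k (F x)))
        ≤ ∫⁻ x, ENNReal.ofReal (RCLike.re (f' x (F x))) := by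
          refine lintegral_mono fun x => ?_
          simp only
          rw [hre, ENNReal.ofReal_mul (hφ x)]
          gcongr
          exact iSup₂_le fun k hk => ENNReal.ofReal_le_ofReal (hκ x k hk)
      _ = ENNReal.ofReal (∫ x, RCLike.re (f' x (F x))) := by
          rw [ofReal_integral_eq_lintegral_ofReal hint.re]
          refine Eventually.of_forall fun x => ?_
          exact (mul_nonneg (hφ x) (hpos x)).trans (hre x).ge
      _ ≤ K := by
          refine le_trans ?_ hb
          rw [← ofReal_norm]
          apply ENNReal.ofReal_le_ofReal
          rw [integral_re hint]
          exact RCLike.re_le_norm _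
  have hsup : ∀ x, ENNReal.ofReal ((φ : Rd d → ℝ) x) * ⨆ k, ENNReal.ofReal (RCLike.re (Λ k (F x)))
      = ⨆ m : ℕ, ENNReal.ofReal ((φ : Rd d → ℝ) x) *
        ⨆ k, ⨆ _ : k ≤ m, ENNReal.ofReal (RCLike.re (Λ k (F x))) := by
    intro x
    rw [← ENNReal.mul_iSup]
    congr 1
    refine le_antisymm (iSup_le fun k => ?_) (iSup_le fun m => iSup₂_le fun k _ => ?_)
    · exact le_iSup_of_le k (le_iSup₂_of_le k le_rfl le_rfl)
    · exact le_iSup (fun k => ENNReal.ofReal (RCLike.re (Λ k (F x)))) k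
  simp_rw [hsup]
  rw [lintegral_iSup']
  · exact iSup_le hfin
  · intro m
    refine hφm.ennreal_ofReal.mul (AEMeasurable.iSup fun k => AEMeasurable.iSup fun _ => ?_)
    exact (hG k).ennreal_ofReal
  · refine Eventually.of_forall fun x => monotone_nat_of_le_succ fun m => ?_
    gcongr with k
    exact iSup_mono' fun hk : k ≤ m => ⟨hk.trans m.le_succ, le_rfl⟩

/-- The average of a weakly locally integrable function over a compact set, as a vector of a
reflexive space. The bound on the pairings makes `l ↦ ∫_D l (F x) dx` a bounded functional. -/
theorem exists_average (hB : IsReflexive 𝕜 B) {F : Rd d → B} (hF : ∀ l : StrongDual 𝕜 B,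
    LocallyIntegrable (fun x => l (F x)) volume) {D : Set (Rd d)} (hD : MeasurableSet D)
    (hDc : IsCompact D) {K : ℝ≥0∞} (hKt : K ≠ ∞)
    (hK : ∀ f : simpleSpace d 𝕜 (StrongDual 𝕜 B),
      (∀ x, ‖(f : Rd d → StrongDual 𝕜 B) x‖ ≤ D.indicator 1 x) → ‖pairing F f.1‖ₑ ≤ K) :
    ∃ a : B, ∀ l : StrongDual 𝕜 B, l a = ⨍ x in D, l (F x) := by
  have hint : ∀ l : StrongDual 𝕜 B, Integrable (fun x => l (F x)) (volume.restrict D) := fun l =>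
    (hF l).integrableOn_isCompact hDc
  let J : StrongDual 𝕜 B →ₗ[𝕜] 𝕜 :=
    { toFun := fun l => ∫ x in D, l (F x)
      map_add' := fun l m => integral_add (hint l) (hint m)
      map_smul' := fun c l => integral_const_mul (μ := volume.restrict D) c (fun x => l (F x)) }
  have hJ : ∀ l, ‖J l‖ ≤ K.toReal * ‖l‖ := by
    intro l
    by_cases hl : l = 0
    · simp [hl]
    have hl' : 0 < ‖l‖ := norm_pos_iff.2 hl
    let m : StrongDual 𝕜 B := ((‖l‖⁻¹ : ℝ) : 𝕜) • l
    have hm : ‖m‖ = 1 := by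
      simp only [m, norm_smul, RCLike.norm_ofReal, abs_inv, abs_norm]
      exact inv_mul_cancel₀ hl'.ne'
    have h1 := hK ⟨D.indicator fun _ => m,
      indicator_const_mem_simpleSpace hD.nullMeasurableSet hDc Subset.rfl m⟩ (fun x => by
        by_cases hx : x ∈ D <;> simp [hx, hm])
    have h2 : pairing F (D.indicator fun _ => m) = J m := by
      simp only [pairing, J, LinearMap.coe_mk, AddHom.coe_mk]
      rw [← integral_indicator hD]
      refine integral_congr_ae (Eventually.of_forall fun x => ?_)
      by_cases hx : x ∈ D <;> simp [hx]
    simp only [h2] at h1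
    have h3 : ‖J m‖ ≤ K.toReal := by
      rw [← toReal_enorm]
      exact ENNReal.toReal_mono hKt h1
    have h4 : J l = ((‖l‖ : ℝ) : 𝕜) • J m := by
      rw [← map_smul]
      congr 1
      simp only [m, smul_smul]
      rw [← RCLike.ofReal_mul, mul_inv_cancel₀ hl'.ne']
      simp
    rw [h4, norm_smul, RCLike.norm_ofReal, abs_norm, mul_comm]
    gcongr
  obtain ⟨b, hb⟩ := hB (J.mkContinuous _ hJ)
  refine ⟨(((volume.real D)⁻¹ : ℝ) : 𝕜) • b, fun l => ?_⟩
  have h1 : l b = ∫ x in D, l (F x) := by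
    rw [← NormedSpace.dual_def 𝕜 B b l, hb]; rfl
  rw [setAverage_eq, map_smul, h1, RCLike.real_smul_eq_coe_mul, smul_eq_mul]

/-- A weakly locally integrable function with values in a reflexive space, whose pairings with
bounded simple functions are locally bounded, is weakly equal to a strongly measurable function
`g`, and `∫ φ ‖g‖` is controlled by the pairings with the simple functions bounded by `φ`. The value
`g x` is a weak cluster point of averages of `F` over small balls near `x`, with countably many
possible centres. -/
theorem exists_strong_representative [CompleteSpace B] (hB : IsReflexive 𝕜 B) {F : Rd d → B}
    (hF : ∀ l : StrongDual 𝕜 B, LocallyIntegrable (fun x => l (F x)) volume)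
    (hb : ∀ R : ℝ, ∃ K : ℝ≥0∞, K ≠ ∞ ∧ ∀ f : simpleSpace d 𝕜 (StrongDual 𝕜 B),
      (∀ x, ‖(f : Rd d → StrongDual 𝕜 B) x‖ ≤ (Metric.closedBall 0 R).indicator 1 x) →
        ‖pairing F f.1‖ₑ ≤ K) :
    ∃ g : Rd d → B, AEStronglyMeasurable g volume ∧ WeakEq 𝕜 F g ∧
      ∀ (φ : simpleSpace d ℝ ℝ) (K : ℝ≥0∞), (∀ x, 0 ≤ (φ : Rd d → ℝ) x) →
        (∀ f : simpleSpace d 𝕜 (StrongDual 𝕜 B),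
          (∀ x, ‖(f : Rd d → StrongDual 𝕜 B) x‖ ≤ (φ : Rd d → ℝ) x) → ‖pairing F f.1‖ₑ ≤ K) →
        ∫⁻ x, ENNReal.ofReal ((φ : Rd d → ℝ) x) * ‖g x‖ₑ ≤ K := by
  let w : ℕ → Rd d := TopologicalSpace.denseSeq (Rd d)
  let δ : ℕ → ℝ := fun n => (1 / 2 : ℝ) ^ n
  have hδ : Tendsto δ atTop (𝓝[>] 0) := by
    refine tendsto_nhdsWithin_iff.2 ⟨tendsto_pow_atTop_nhds_zero_of_lt_one (by norm_num) (by norm_num), ?_⟩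
    exact Eventually.of_forall fun n => by
      show 0 < δ n
      simp only [δ]; positivity
  have hD : ∀ i n, ∃ R : ℝ, Metric.closedBall (w i) (δ n) ⊆ Metric.closedBall 0 R := fun i n =>
    (Metric.isBounded_closedBall.subset_closedBall 0)
  have hav : ∀ i n, ∃ a : B, ∀ l : StrongDual 𝕜 B,
      l a = ⨍ x in Metric.closedBall (w i) (δ n), l (F x) := by
    intro i n
    obtain ⟨R, hR⟩ := hD i n
    obtain ⟨K, hKt, hK⟩ := hb R
    refine exists_average hB hF measurableSet_closedBall (isCompact_closedBall _ _) hKt fun f hf => ?_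
    exact hK f fun x => (hf x).trans (indicator_le_indicator_of_subset hR (fun _ => zero_le_one) x)
  choose a ha using hav
  let V : Submodule 𝕜 B := (Submodule.span 𝕜 (range fun p : ℕ × ℕ => a p.1 p.2)).topologicalClosure
  have hVc : IsClosed (V : Set B) := Submodule.isClosed_topologicalClosure _
  have hVs : TopologicalSpace.IsSeparable (V : Set B) := by
    rw [Submodule.topologicalClosure_coe]
    exact ((countable_range _).isSeparable.span).closure
  have haV : ∀ i n, a i n ∈ V := fun i n =>
    Submodule.le_topologicalClosure _ (Submodule.subset_span ⟨(i, n), rfl⟩)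
  obtain ⟨Λ, hΛ0, hΛ1, hΛ⟩ := exists_norming_seq V hVs
  let h : Rd d → ℝ≥0∞ := fun x => ⨆ k, ENNReal.ofReal (RCLike.re (Λ k (F x)))
  have hhm : AEMeasurable h volume := AEMeasurable.iSup fun k =>
    (RCLike.continuous_re.measurable.comp_aemeasurable
      (hF (Λ k)).aestronglyMeasurable.aemeasurable).ennreal_ofReal
  have hφ : ∀ (φ : simpleSpace d ℝ ℝ) (K : ℝ≥0∞), (∀ x, 0 ≤ (φ : Rd d → ℝ) x) →
        (∀ f : simpleSpace d 𝕜 (StrongDual 𝕜 B),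
          (∀ x, ‖(f : Rd d → StrongDual 𝕜 B) x‖ ≤ (φ : Rd d → ℝ) x) → ‖pairing F f.1‖ₑ ≤ K) →
        ∫⁻ x, ENNReal.ofReal ((φ : Rd d → ℝ) x) * h x ≤ K := fun φ K h0 hK =>
    lintegral_iSup_re_le hF Λ hΛ0 hΛ1 φ h0 K hK
  have hball : ∀ R : ℝ, ∫⁻ x in Metric.closedBall 0 R, h x < ∞ := by
    intro R
    obtain ⟨K, hKt, hK⟩ := hb R
    refine lt_of_le_of_lt ?_ hKt.lt_top
    have := hφ ⟨(Metric.closedBall 0 R).indicator fun _ => 1, indicator_const_mem_simpleSpace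
      measurableSet_closedBall.nullMeasurableSet (isCompact_closedBall _ _) Subset.rfl 1⟩ K
      (fun x => indicator_nonneg (fun _ _ => zero_le_one) x) hK
    rw [← lintegral_indicator measurableSet_closedBall]
    refine le_trans (lintegral_mono fun x => ?_) this
    by_cases hx : x ∈ Metric.closedBall (0 : Rd d) R <;> simp only [hx, indicator_of_mem,
      indicator_of_notMem, not_false_eq_true] <;> simp
  have hint : ∀ R : ℝ, IntegrableOn (fun x => (h x).toReal) (Metric.closedBall 0 R) volume := fun R =>
    integrable_toReal_of_lintegral_ne_top hhm.restrict (hball R).ne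
  have hloc : LocallyIntegrable (fun x => (h x).toReal) volume := by
    intro x
    refine ⟨Metric.closedBall 0 (‖x‖ + 1), ?_, hint _⟩
    refine mem_of_superset (Metric.ball_mem_nhds x one_pos) fun y hy => ?_
    rw [Metric.mem_ball, dist_eq_norm] at hy
    rw [mem_closedBall_zero_iff]
    have := norm_le_norm_add_norm_sub' y x
    linarith
  have hfin : ∀ᵐ x ∂(volume : Measure (Rd d)), h x ≠ ∞ := by
    have h1 : ∀ n : ℕ, ∀ᵐ x ∂(volume : Measure (Rd d)), x ∈ Metric.closedBall (0 : Rd d) n → h x ≠ ∞ := by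
      intro n
      rw [← ae_restrict_iff' measurableSet_closedBall]
      filter_upwards [ae_lt_top' hhm.restrict (hball n).ne] with x hx using hx.ne
    filter_upwards [ae_all_iff.2 h1] with x hx
    obtain ⟨n, hn⟩ := exists_nat_ge ‖x‖
    exact hx n (by simpa using hn)
  -- The averages are bounded by those of `h`.
  have hab : ∀ i n, ‖a i n‖ ≤ ⨍ x in Metric.closedBall (w i) (δ n), (h x).toReal := by
    intro i n
    set D := Metric.closedBall (w i) (δ n) with hDdef
    have hhD : IntegrableOn (fun x => (h x).toReal) D volume :=
      hloc.integrableOn_isCompact (isCompact_closedBall _ _)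
    have h0 : 0 ≤ ⨍ x in D, (h x).toReal := by
      rw [setAverage_eq]
      exact smul_nonneg (by positivity) (integral_nonneg fun x => ENNReal.toReal_nonneg)
    rw [← ENNReal.ofReal_le_ofReal_iff h0, ofReal_norm, hΛ _ (haV i n)]
    refine iSup_le fun k => ENNReal.ofReal_le_ofReal ?_
    rw [ha, setAverage_eq, setAverage_eq, RCLike.smul_re, smul_eq_mul]
    have hk : Integrable (fun x => Λ k (F x)) (volume.restrict D) :=
      (hF (Λ k)).integrableOn_isCompact (isCompact_closedBall _ _)
    rw [← integral_re hk]
    refine mul_le_mul_of_nonneg_left ?_ (by positivity)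
    refine integral_mono_ae hk.re hhD ?_
    filter_upwards [ae_restrict_of_ae hfin] with x hx
    rw [← ENNReal.ofReal_le_iff_le_toReal hx]
    exact le_iSup (fun k => ENNReal.ofReal (RCLike.re (Λ k (F x)))) k
  have hw : ∀ x n, ∃ i, x ∈ Metric.closedBall (w i) (1 * δ n) := by
    intro x n
    have := Metric.denseRange_iff.1 (TopologicalSpace.denseRange_denseSeq (Rd d)) x (δ n)
      (by simp only [δ]; positivity)
    obtain ⟨i, hi⟩ := this
    exact ⟨i, by rw [one_mul]; exact hi.le⟩
  choose ι hι using hw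
  have hlim : ∀ᵐ x ∂(volume : Measure (Rd d)), ∃ M : ℝ, ∀ᶠ n in atTop, ‖a (ι x n) n‖ ≤ M := by
    filter_upwards [IsUnifLocDoublingMeasure.ae_tendsto_average volume hloc 1] with x hx
    have := hx (fun n => w (ι x n)) δ hδ (Eventually.of_forall fun n => hι x n)
    refine ⟨(h x).toReal + 1, ?_⟩
    filter_upwards [this.eventually_lt_const (lt_add_one _)] with n hn
    exact (hab _ _).trans hn.le
  have hex : ∀ x, ∃ b ∈ V, (∃ M : ℝ, ∀ᶠ n in atTop, ‖a (ι x n) n‖ ≤ M) →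
      ∀ (l : StrongDual 𝕜 B) (z : 𝕜), Tendsto (fun n => l (a (ι x n) n)) atTop (𝓝 z) → l b = z := by
    intro x
    by_cases hM : ∃ M : ℝ, ∀ᶠ n in atTop, ‖a (ι x n) n‖ ≤ M
    · obtain ⟨M, hM'⟩ := hM
      obtain ⟨b, hb⟩ := hB.exists_weak_cluster (fun n => a (ι x n) n) M hM'
      refine ⟨b, ?_, fun _ => hb⟩
      by_contra hbV
      obtain ⟨l, hl, hl0⟩ := exists_dual_separating V hVc hbV
      refine hl (hb l 0 ?_)
      simp only [hl0 _ (haV _ _), tendsto_const_nhds]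
    · exact ⟨0, V.zero_mem, fun h => absurd h hM⟩
  choose g hgV hg using hex
  have hweak : WeakEq 𝕜 F g := by
    intro l
    filter_upwards [hlim, IsUnifLocDoublingMeasure.ae_tendsto_average volume (hF l) 1] with x hx hx'
    refine (hg x hx l _ ?_).symm
    simp only [ha]
    exact hx' (fun n => w (ι x n)) δ hδ (Eventually.of_forall fun n => hι x n)
  refine ⟨g, ?_, hweak, fun φ K h0 hK => ?_⟩
  · refine aestronglyMeasurable_of_mem V hVc hVs g hgV fun l => ?_
    refine (RCLike.continuous_re.measurable.comp_aemeasurable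
      (hF l).aestronglyMeasurable.aemeasurable).congr ?_
    filter_upwards [hweak l] with x hx
    rw [Function.comp_apply, hx]
  · refine le_trans (le_of_eq (lintegral_congr_ae ?_)) (hφ φ K h0 hK)
    filter_upwards [ae_all_iff.2 fun k => hweak (Λ k)] with x hx
    simp only [h, hΛ _ (hgV x), hx]

end Representative

/-! ### Lebesgue and Lorentz norms -/

theorem lintegral_Ioo_rpow {b s : ℝ} (hb : 0 < b) (hs : -1 < s) :
    ∫⁻ t in Ioo 0 b, ENNReal.ofReal (t ^ s) = ENNReal.ofReal (b ^ (s + 1) / (s + 1)) := by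
  have h1 : IntegrableOn (fun t : ℝ => t ^ s) (Ioo 0 b) volume :=
    (intervalIntegral.integrableOn_Ioo_rpow_iff hb).2 hs
  rw [← ofReal_integral_eq_lintegral_ofReal h1, ← integral_Ioc_eq_integral_Ioo,
    ← intervalIntegral.integral_of_le hb.le, integral_rpow (Or.inl hs),
    Real.zero_rpow (by linarith), sub_zero]
  refine (ae_restrict_iff' measurableSet_Ioo).2 (Eventually.of_forall fun t ht => ?_)
  exact Real.rpow_nonneg ht.1.le _

theorem lintegral_Ioi_rpow {a s : ℝ} (ha : 0 < a) (hs : s < -1) :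
    ∫⁻ t in Ioi a, ENNReal.ofReal (t ^ s) = ENNReal.ofReal (a ^ (s + 1) / (-(s + 1))) := by
  rw [← ofReal_integral_eq_lintegral_ofReal (integrableOn_Ioi_rpow_of_lt hs ha),
    integral_Ioi_rpow_of_lt hs ha, div_neg, neg_div]
  refine (ae_restrict_iff' measurableSet_Ioi).2 (Eventually.of_forall fun t ht => ?_)
  exact Real.rpow_nonneg (ha.le.trans (le_of_lt ht)) _

section Norms

variable {d : ℕ} {B : Type*} [NormedAddCommGroup B]

theorem lebesgueNorm_eq {p : ℝ} (hp : 0 < p) (f : Rd d → B) :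
    lebesgueNorm p f = (∫⁻ x, ‖f x‖ₑ ^ p) ^ (1 / p) := by
  rw [lebesgueNorm, eLpNorm_eq_lintegral_rpow_enorm_toReal (by simpa using hp) ENNReal.ofReal_ne_top,
    ENNReal.toReal_ofReal hp.le]

theorem simpleFunc_mem_simpleSpace (φ : SimpleFunc (Rd d) ℝ) {K : Set (Rd d)} (hK : IsCompact K)
    (h : ∀ x ∉ K, φ x = 0) : (φ : Rd d → ℝ) ∈ simpleSpace d ℝ ℝ :=
  ⟨φ.finite_range, fun b => (φ.measurableSet_fiber b).nullMeasurableSet, HasCompactSupport.intro hK h⟩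

/-- The converse of Hölder's inequality, tested on simple functions. -/
theorem lintegral_rpow_le_of_simple {q : ℝ} (hq : 1 < q) {h : Rd d → ℝ≥0∞}
    (hh : AEMeasurable h volume) {K : ℝ≥0∞}
    (hK : ∀ φ : simpleSpace d ℝ ℝ, (∀ x, 0 ≤ (φ : Rd d → ℝ) x) →
      ∫⁻ x, ENNReal.ofReal ((φ : Rd d → ℝ) x) * h x ≤
        K * (∫⁻ x, ENNReal.ofReal ((φ : Rd d → ℝ) x) ^ (q / (q - 1))) ^ (1 / (q / (q - 1)))) :
    (∫⁻ x, h x ^ q) ^ (1 / q) ≤ K := by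
  have hq0 : 0 < q := by linarith
  have hq1 : 0 < q - 1 := by linarith
  let ψ : ℕ → SimpleFunc (Rd d) ℝ≥0∞ := fun n =>
    (SimpleFunc.eapprox (hh.mk h) n).restrict (Metric.closedBall 0 n)
  have hψ : ∀ n x, ψ n x = (Metric.closedBall (0 : Rd d) n).indicator
      (SimpleFunc.eapprox (hh.mk h) n) x := fun n x =>
    SimpleFunc.restrict_apply _ measurableSet_closedBall x
  have hψtop : ∀ n x, ψ n x ≠ ∞ := by
    intro n x
    rw [hψ]
    by_cases hx : x ∈ Metric.closedBall (0 : Rd d) n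
    · rw [indicator_of_mem hx]; exact (SimpleFunc.eapprox_lt_top _ _ _).ne
    · simp [indicator_of_notMem hx]
  have hψ0 : ∀ n : ℕ, ∀ x ∉ Metric.closedBall (0 : Rd d) n, ψ n x = 0 := by
    intro n x hx
    rw [hψ, indicator_of_notMem hx]
  have hψle : ∀ n x, ψ n x ≤ hh.mk h x := by
    intro n x
    rw [hψ]
    refine (indicator_le_self _ _ x).trans ?_
    rw [← SimpleFunc.iSup_eapprox_apply hh.measurable_mk x]
    exact le_iSup (fun n => (SimpleFunc.eapprox (hh.mk h) n : Rd d → ℝ≥0∞) x) n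
  have hψmono : ∀ x, Monotone fun n => ψ n x := by
    intro x m n hmn
    simp only [hψ]
    by_cases hx : x ∈ Metric.closedBall (0 : Rd d) m
    · have hx' : x ∈ Metric.closedBall (0 : Rd d) n :=
        Metric.closedBall_subset_closedBall (by exact_mod_cast hmn) hx
      rw [indicator_of_mem hx, indicator_of_mem hx']
      exact SimpleFunc.monotone_eapprox _ hmn x
    · rw [indicator_of_notMem hx]; exact zero_le
  have hψsup : ∀ x, ⨆ n, ψ n x = hh.mk h x := by
    intro x
    refine le_antisymm (iSup_le fun n => hψle n x) ?_
    rw [← SimpleFunc.iSup_eapprox_apply hh.measurable_mk x]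
    refine iSup_le fun n => ?_
    obtain ⟨m, hm⟩ := exists_nat_ge ‖x‖
    refine le_iSup_of_le (max n m) ?_
    rw [hψ, indicator_of_mem]
    · exact SimpleFunc.monotone_eapprox _ (le_max_left _ _) x
    · rw [mem_closedBall_zero_iff]
      exact hm.trans (by exact_mod_cast le_max_right _ _)
  have hfin : ∀ n, ∫⁻ x, ψ n x ^ q ≠ ∞ := by
    intro n
    have h1 : ((ψ n).map (· ^ q)).FinMeasSupp volume := by
      refine SimpleFunc.finMeasSupp_iff.2 fun y hy => ?_
      refine lt_of_le_of_lt (measure_mono fun x hx => ?_)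
        (measure_closedBall_lt_top (μ := volume) (x := (0 : Rd d)) (r := n))
      by_contra hx'
      refine hy ?_
      rw [mem_preimage, mem_singleton_iff, SimpleFunc.map_apply, hψ0 n x hx',
        ENNReal.zero_rpow_of_pos hq0] at hx
      exact hx.symm
    have h2 := h1.lintegral_lt_top (Eventually.of_forall fun x => by
      rw [SimpleFunc.map_apply]
      exact ENNReal.rpow_ne_top_of_nonneg hq0.le (hψtop n x))
    rw [← SimpleFunc.lintegral_eq_lintegral] at h2
    simpa using h2.ne
  have hmain : ∀ n, ∫⁻ x, ψ n x ^ q ≤ K ^ q := by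
    intro n
    let φ : SimpleFunc (Rd d) ℝ := (ψ n).map fun v => v.toReal ^ (q - 1)
    have hφ : ∀ x, ENNReal.ofReal (φ x) = ψ n x ^ (q - 1) := by
      intro x
      simp only [φ, SimpleFunc.map_apply]
      rw [ENNReal.toReal_rpow, ENNReal.ofReal_toReal]
      exact ENNReal.rpow_ne_top_of_nonneg hq1.le (hψtop n x)
    have h1 := hK ⟨φ, simpleFunc_mem_simpleSpace φ (isCompact_closedBall 0 (n : ℝ)) fun x hx => by
      simp only [φ, SimpleFunc.map_apply, hψ0 n x hx]
      simp [Real.zero_rpow hq1.ne']⟩ (fun x => by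
        simp only [φ, SimpleFunc.map_apply]
        positivity)
    simp only [hφ] at h1
    have h2 : ∀ x, (ψ n x ^ (q - 1)) ^ (q / (q - 1)) = ψ n x ^ q := by
      intro x
      rw [← ENNReal.rpow_mul, mul_div_cancel₀ _ hq1.ne']
    simp only [h2] at h1
    set I := ∫⁻ x, ψ n x ^ q
    have h3 : I ≤ K * I ^ (1 / (q / (q - 1))) := by
      refine le_trans (lintegral_mono_ae ?_) h1
      filter_upwards [hh.ae_eq_mk] with x hx
      have : ψ n x ^ q = ψ n x ^ (q - 1) * ψ n x := by
        nth_rewrite 3 [← ENNReal.rpow_one (ψ n x)]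
        rw [← ENNReal.rpow_add_of_nonneg _ _ hq1.le zero_le_one, sub_add_cancel]
      rw [this, hx]
      gcongr
      exact hψle n x
    by_cases hI : I = 0
    · rw [hI]; exact zero_le
    have h4 : I = I ^ (1 / q) * I ^ (1 / (q / (q - 1))) := by
      rw [← ENNReal.rpow_add _ _ hI (hfin n)]
      have : 1 / q + 1 / (q / (q - 1)) = 1 := by field_simp; ring
      rw [this, ENNReal.rpow_one]
    have h5 : I ^ (1 / q) ≤ K := by
      have h6 : I ^ (1 / (q / (q - 1))) ≠ 0 := by
        rw [Ne, ENNReal.rpow_eq_zero_iff]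
        exact fun h => h.elim (fun h => hI h.1) fun h => hfin n h.1
      have h7 : I ^ (1 / (q / (q - 1))) ≠ ∞ :=
        ENNReal.rpow_ne_top_of_nonneg (by positivity) (hfin n)
      nth_rewrite 1 [h4] at h3
      exact (ENNReal.mul_le_mul_iff_left h6 h7).1 h3
    calc I = (I ^ (1 / q)) ^ q := by
          rw [← ENNReal.rpow_mul, one_div_mul_cancel hq0.ne', ENNReal.rpow_one]
      _ ≤ K ^ q := by gcongr
  have hlim : ∫⁻ x, h x ^ q = ⨆ n, ∫⁻ x, ψ n x ^ q := by
    rw [← lintegral_iSup]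
    · refine lintegral_congr_ae ?_
      filter_upwards [hh.ae_eq_mk] with x hx
      rw [hx, ← hψsup x]
      exact (ENNReal.orderIsoRpow q hq0).map_iSup _
    · exact fun n => (ψ n).measurable.pow_const q
    · intro m n hmn x
      exact ENNReal.rpow_le_rpow (hψmono x hmn) hq0.le
  rw [hlim]
  calc (⨆ n, ∫⁻ x, ψ n x ^ q) ^ (1 / q) ≤ (K ^ q) ^ (1 / q) := by
        gcongr
        exact iSup_le hmain
    _ = K := by rw [← ENNReal.rpow_mul, mul_one_div_cancel hq0.ne', ENNReal.rpow_one]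

theorem rearrangement_antitone (f : Rd d → B) {s t : ℝ} (h : s ≤ t) :
    rearrangement f t ≤ rearrangement f s :=
  sInf_le_sInf fun _ hr => le_trans hr (ENNReal.ofReal_le_ofReal h)

theorem rearrangement_le_maxRearrangement (f : Rd d → B) {t : ℝ} (ht : 0 < t) :
    rearrangement f t ≤ maxRearrangement f t := by
  rw [maxRearrangement]
  have h1 : ENNReal.ofReal t ≠ 0 := by simpa using ht
  calc rearrangement f t = (ENNReal.ofReal t)⁻¹ * ∫⁻ _ in Ioo 0 t, rearrangement f t := by
        rw [setLIntegral_const, Real.volume_Ioo, sub_zero, mul_comm (rearrangement f t), ← mul_assoc,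
          ENNReal.inv_mul_cancel h1 ENNReal.ofReal_ne_top, one_mul]
    _ ≤ _ := by
        gcongr (ENNReal.ofReal t)⁻¹ * ?_
        exact setLIntegral_mono' measurableSet_Ioo fun s hs => rearrangement_antitone f hs.2.le

/-- The weak Lorentz norm is controlled by integrals over bounded sets. -/
theorem weakLorentzNorm_le {p : ℝ} (hp : 1 < p) {g : Rd d → B} (hg : AEStronglyMeasurable g volume)
    {K : ℝ≥0∞} (hKt : K ≠ ∞)
    (hK : ∀ E : Set (Rd d), NullMeasurableSet E volume → Bornology.IsBounded E →
      ∫⁻ x in E, ‖g x‖ₑ ≤ K * volume E ^ (1 - 1 / p)) :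
    weakLorentzNorm p g ≤ ENNReal.ofReal (p / (p - 1)) * K := by
  have hp0 : 0 < p := by linarith
  have hp1 : 0 < p - 1 := by linarith
  -- The distribution function is estimated on bounded superlevel sets, which have finite measure.
  have hdist : ∀ s : ℝ≥0∞, s ≠ 0 → s ≠ ∞ → volume {x : Rd d | s < ‖g x‖ₑ} ≤ (K / s) ^ p := by
    intro s hs0 hst
    have hnull : NullMeasurableSet {x : Rd d | s < ‖g x‖ₑ} volume :=
      nullMeasurableSet_lt aemeasurable_const hg.enorm
    have hU : {x : Rd d | s < ‖g x‖ₑ} = ⋃ n : ℕ, {x | s < ‖g x‖ₑ} ∩ Metric.closedBall 0 n := by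
      rw [← inter_iUnion, Metric.iUnion_closedBall_nat, inter_univ]
    have hmono : Monotone fun n : ℕ => {x : Rd d | s < ‖g x‖ₑ} ∩ Metric.closedBall 0 n :=
      fun m n hmn => inter_subset_inter_right _
        (Metric.closedBall_subset_closedBall (by exact_mod_cast hmn))
    rw [hU, hmono.measure_iUnion]
    refine iSup_le fun n => ?_
    set E := {x : Rd d | s < ‖g x‖ₑ} ∩ Metric.closedBall 0 n with hE
    have hEt : volume E ≠ ∞ := ((measure_mono inter_subset_right).trans_lt
      (measure_closedBall_lt_top (μ := volume) (x := (0 : Rd d)) (r := n))).ne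
    by_cases hE0 : volume E = 0
    · rw [hE0]; exact zero_le
    have hEn : NullMeasurableSet E volume := hnull.inter measurableSet_closedBall.nullMeasurableSet
    have h1 : s * volume E ≤ K * volume E ^ (1 - 1 / p) := by
      refine le_trans ?_ (hK E hEn (Metric.isBounded_closedBall.subset inter_subset_right))
      rw [← setLIntegral_const]
      refine lintegral_mono_ae ?_
      filter_upwards [ae_restrict_mem₀ hEn] with x hx using hx.1.le
    have h2 : volume E = volume E ^ (1 / p) * volume E ^ (1 - 1 / p) := by
      rw [← ENNReal.rpow_add _ _ hE0 hEt]; simp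
    nth_rewrite 1 [h2] at h1
    rw [← mul_assoc] at h1
    have h3 : volume E ^ (1 - 1 / p) ≠ 0 := by simp [ENNReal.rpow_eq_zero_iff, hE0, hEt]
    have h4 : volume E ^ (1 - 1 / p) ≠ ∞ := by
      simp [ENNReal.rpow_eq_top_iff, hE0, hEt]
    have h5 : volume E ^ (1 / p) ≤ K / s := by
      rw [ENNReal.le_div_iff_mul_le (Or.inl hs0) (Or.inl hst), mul_comm]
      exact (ENNReal.mul_le_mul_iff_left h3 h4).1 h1
    calc volume E = (volume E ^ (1 / p)) ^ p := by
          rw [← ENNReal.rpow_mul, one_div_mul_cancel hp0.ne', ENNReal.rpow_one]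
      _ ≤ _ := by gcongr
  have hre : ∀ t : ℝ, 0 < t → rearrangement g t ≤ K * ENNReal.ofReal (t ^ (-1 / p)) := by
    intro t ht
    refine le_of_forall_gt_imp_ge_of_dense fun s hs => ?_
    by_cases hst : s = ∞
    · rw [hst]; exact le_top
    have hs0 : s ≠ 0 := (zero_le.trans_lt hs).ne'
    refine sInf_le ?_
    refine (hdist s hs0 hst).trans ?_
    have h1 : ENNReal.ofReal (t ^ (-1 / p)) = (ENNReal.ofReal t ^ (1 / p))⁻¹ := by
      rw [← ENNReal.ofReal_rpow_of_pos ht, neg_div, ENNReal.rpow_neg]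
    have h2 : K / s ≤ ENNReal.ofReal t ^ (1 / p) := by
      refine ENNReal.div_le_of_le_mul ?_
      rw [h1, ← div_eq_mul_inv] at hs
      rw [mul_comm]
      refine (ENNReal.div_le_iff_le_mul ?_ ?_).1 hs.le
      · left; simp [ENNReal.rpow_eq_zero_iff, ht]
      · left; exact ENNReal.rpow_ne_top_of_nonneg (by positivity) ENNReal.ofReal_ne_top
    calc (K / s) ^ p ≤ (ENNReal.ofReal t ^ (1 / p)) ^ p := by gcongr
      _ = _ := by rw [← ENNReal.rpow_mul, one_div_mul_cancel hp0.ne', ENNReal.rpow_one]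
  refine iSup₂_le fun t (ht : 0 < t) => ?_
  have h1 : ∫⁻ s in Ioo 0 t, rearrangement g s ≤
      K * ENNReal.ofReal (t ^ (1 - 1 / p) * (p / (p - 1))) := by
    calc ∫⁻ s in Ioo 0 t, rearrangement g s
        ≤ ∫⁻ s in Ioo 0 t, K * ENNReal.ofReal (s ^ (-1 / p)) :=
          setLIntegral_mono' measurableSet_Ioo fun s hs => hre s hs.1
      _ = _ := by
          rw [lintegral_const_mul' _ _ hKt, lintegral_Ioo_rpow ht]
          · congr 3
            have : -1 / p + 1 = 1 - 1 / p := by ring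
            rw [this]
            field_simp
          · rw [lt_div_iff₀ hp0]; linarith
  rw [maxRearrangement]
  calc ENNReal.ofReal (t ^ (1 / p)) * ((ENNReal.ofReal t)⁻¹ * ∫⁻ s in Ioo 0 t, rearrangement g s)
      ≤ ENNReal.ofReal (t ^ (1 / p)) * ((ENNReal.ofReal t)⁻¹ *
        (K * ENNReal.ofReal (t ^ (1 - 1 / p) * (p / (p - 1))))) := by gcongr
    _ = ENNReal.ofReal (t ^ (1 / p) * (t⁻¹ * (t ^ (1 - 1 / p) * (p / (p - 1))))) * K := by
        rw [ENNReal.ofReal_mul (p := t ^ (1 / p)) (by positivity),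
          ENNReal.ofReal_mul (p := t⁻¹) (by positivity), ENNReal.ofReal_inv_of_pos ht]
        ring
    _ = _ := by
        congr 2
        have : t ^ (1 / p) * t ^ (1 - 1 / p) = t := by
          rw [← Real.rpow_add ht]; simp
        calc t ^ (1 / p) * (t⁻¹ * (t ^ (1 - 1 / p) * (p / (p - 1))))
            = (t ^ (1 / p) * t ^ (1 - 1 / p)) * t⁻¹ * (p / (p - 1)) := by ring
          _ = _ := by rw [this, mul_inv_cancel₀ ht.ne', one_mul]

theorem sum_two_zpow_le (s : Finset ℤ) (n : ℤ) (hs : ∀ k ∈ s, k ≤ n) :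
    ∑ k ∈ s, (2 : ℝ≥0∞) ^ k ≤ 2 * 2 ^ n := by
  have hinj : Set.InjOn (fun k : ℤ => (n - k).toNat) s := by
    intro a ha b hb hab
    have := hs a ha
    have := hs b hb
    simp only at hab
    omega
  have h1 : ∀ k ∈ s, (2 : ℝ≥0∞) ^ k = 2 ^ n * 2⁻¹ ^ (n - k).toNat := by
    intro k hk
    have : k = n + (-((n - k).toNat : ℤ)) := by have := hs k hk; omega
    conv_lhs => rw [this]
    rw [ENNReal.zpow_add (by simp) (by simp), ENNReal.zpow_neg, zpow_natCast, ENNReal.inv_pow]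
  rw [Finset.sum_congr rfl h1, ← Finset.mul_sum, mul_comm]
  gcongr
  rw [← Finset.sum_image (f := fun m : ℕ => (2 : ℝ≥0∞)⁻¹ ^ m) hinj]
  refine (ENNReal.sum_le_tsum _).trans (le_of_eq ?_)
  rw [ENNReal.tsum_geometric, ENNReal.one_sub_inv_two, inv_inv]

/-- The norm of `L^{q,1}` dominates a sum over dyadic layers: the rearrangement of `f` is at least
`2 ^ k` on the interval `(0, |E k|)`, and for fixed `t` the powers `2 ^ k` with `t < |E k|` form a part
of a geometric series. -/
theorem sum_two_zpow_mul_le_lorentzOneNorm {q : ℝ} (hq : 1 < q) (f : Rd d → B) (s : Finset ℤ)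
    (E : ℤ → Set (Rd d)) (hE : ∀ k, volume (E k) ≠ ∞) (hf : ∀ k, ∀ x ∈ E k, (2 : ℝ≥0∞) ^ k ≤ ‖f x‖ₑ) :
    ∑ k ∈ s, (2 : ℝ≥0∞) ^ k * volume (E k) ^ (1 / q) ≤ 2 * lorentzOneNorm q f := by
  classical
  have hq0 : 0 < q := by linarith
  have hre : ∀ k, ∀ t, ENNReal.ofReal t < volume (E k) → (2 : ℝ≥0∞) ^ k ≤ rearrangement f t := by
    intro k t ht
    refine le_sInf fun r hr => ?_
    by_contra! hrk
    refine absurd (lt_of_lt_of_le ht (measure_mono fun x hx => ?_)) (not_lt.2 hr)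
    exact hrk.trans_le (hf k x hx)
  have hpt : ∀ t : ℝ, 0 < t → ∑ k ∈ s, (Iio (volume (E k)).toReal).indicator (fun _ => (2 : ℝ≥0∞) ^ k) t ≤
      2 * rearrangement f t := by
    intro t ht
    simp only [indicator_apply, mem_Iio]
    rw [← Finset.sum_filter]
    rcases (s.filter fun k => t < (volume (E k)).toReal).eq_empty_or_nonempty with h0 | h0
    · rw [h0]; simp
    · refine (sum_two_zpow_le _ (Finset.max' _ h0) fun k hk => Finset.le_max' _ k hk).trans ?_
      gcongr
      have hn := (Finset.mem_filter.1 (Finset.max'_mem _ h0)).2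
      exact hre _ t ((ENNReal.ofReal_lt_iff_lt_toReal ht.le (hE _)).2 hn)
  have hint : ∀ k, (2 : ℝ≥0∞) ^ k * volume (E k) ^ (1 / q) = ENNReal.ofReal (1 / q) *
      ∫⁻ t in Ioi (0 : ℝ), ENNReal.ofReal (t ^ (1 / q - 1)) *
        (Iio (volume (E k)).toReal).indicator (fun _ => (2 : ℝ≥0∞) ^ k) t := by
    intro k
    have h2 : (2 : ℝ≥0∞) ^ k ≠ ∞ := ENNReal.zpow_ne_top (by simp) (by simp) k
    have h1 : ∀ t : ℝ, ENNReal.ofReal (t ^ (1 / q - 1)) *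
        (Iio (volume (E k)).toReal).indicator (fun _ => (2 : ℝ≥0∞) ^ k) t =
        (Iio (volume (E k)).toReal).indicator
          (fun t => (2 : ℝ≥0∞) ^ k * ENNReal.ofReal (t ^ (1 / q - 1))) t := by
      intro t
      by_cases ht : t ∈ Iio (volume (E k)).toReal
      · rw [indicator_of_mem ht, indicator_of_mem ht, mul_comm]
      · rw [indicator_of_notMem ht, indicator_of_notMem ht, mul_zero]
    simp_rw [h1]
    rw [lintegral_indicator measurableSet_Iio, Measure.restrict_restrict measurableSet_Iio,
      inter_comm, Ioi_inter_Iio, lintegral_const_mul' _ _ h2]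
    by_cases h0 : volume (E k) = 0
    · simp [h0, hq0]
    have hpos : 0 < (volume (E k)).toReal := ENNReal.toReal_pos h0 (hE k)
    have hq' : 0 < 1 / q := by positivity
    rw [lintegral_Ioo_rpow hpos (by linarith), sub_add_cancel, mul_left_comm,
      ← ENNReal.ofReal_mul hq'.le, mul_div_cancel₀ _ hq'.ne', ENNReal.toReal_rpow,
      ENNReal.ofReal_toReal]
    exact ENNReal.rpow_ne_top_of_nonneg hq'.le (hE k)
  calc ∑ k ∈ s, (2 : ℝ≥0∞) ^ k * volume (E k) ^ (1 / q)
      = ENNReal.ofReal (1 / q) * ∫⁻ t in Ioi (0 : ℝ), ENNReal.ofReal (t ^ (1 / q - 1)) *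
        ∑ k ∈ s, (Iio (volume (E k)).toReal).indicator (fun _ => (2 : ℝ≥0∞) ^ k) t := by
        simp_rw [Finset.mul_sum]
        rw [lintegral_finsetSum', Finset.mul_sum]
        · exact Finset.sum_congr rfl fun k _ => hint k
        · intro k _
          refine AEMeasurable.mul ?_ ?_
          · exact (Measurable.ennreal_ofReal (by fun_prop)).aemeasurable
          · exact (measurable_const.indicator measurableSet_Iio).aemeasurable
    _ ≤ ENNReal.ofReal (1 / q) * ∫⁻ t in Ioi (0 : ℝ), ENNReal.ofReal (t ^ (1 / q - 1)) *
        (2 * maxRearrangement f t) := by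
        gcongr ENNReal.ofReal (1 / q) * ?_
        refine setLIntegral_mono' measurableSet_Ioi fun t (ht : 0 < t) => ?_
        gcongr
        exact (hpt t ht).trans (by gcongr; exact rearrangement_le_maxRearrangement f ht)
    _ = 2 * lorentzOneNorm q f := by
        rw [lorentzOneNorm]
        simp_rw [mul_left_comm _ (2 : ℝ≥0∞)]
        rw [lintegral_const_mul' _ _ (by simp), mul_left_comm]

end Norms

/-! ### Sums with weak-type control -/

section WeakSums

variable {ι : Type*}

theorem lintegral_ite_ofReal_lt (w a : ℝ≥0∞) :
    ∫⁻ t in Ioi (0 : ℝ), (if ENNReal.ofReal t < a then w else 0) = w * a := by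
  have hm : MeasurableSet {t : ℝ | ENNReal.ofReal t < a} :=
    measurableSet_lt ENNReal.measurable_ofReal measurable_const
  have h1 : ∀ t : ℝ, (if ENNReal.ofReal t < a then w else 0) =
      {t : ℝ | ENNReal.ofReal t < a}.indicator (fun _ => w) t := fun t => by
    simp [indicator_apply]
  simp_rw [h1]
  rw [lintegral_indicator hm, setLIntegral_const, Measure.restrict_apply hm]
  congr 1
  by_cases ha : a = ∞
  · simp [ha]
  · have : {t : ℝ | ENNReal.ofReal t < a} ∩ Ioi 0 = Ioo 0 a.toReal := by
      ext t
      simp only [mem_inter_iff, mem_ofPred_eq, mem_Ioi, mem_Ioo]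
      constructor
      · rintro ⟨h, ht⟩
        exact ⟨ht, (ENNReal.ofReal_lt_iff_lt_toReal ht.le ha).1 h⟩
      · rintro ⟨ht, h⟩
        exact ⟨(ENNReal.ofReal_lt_iff_lt_toReal ht.le ha).2 h, ht⟩
    rw [this, Real.volume_Ioo, sub_zero, ENNReal.ofReal_toReal ha]

/-- The layer cake formula for finite sums. -/
theorem sum_mul_eq_lintegral (s : Finset ι) (w a : ι → ℝ≥0∞) :
    ∑ i ∈ s, w i * a i =
      ∫⁻ t in Ioi (0 : ℝ), ∑ i ∈ s with ENNReal.ofReal t < a i, w i := by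
  simp_rw [Finset.sum_filter]
  rw [lintegral_finsetSum]
  · exact Finset.sum_congr rfl fun i _ => (lintegral_ite_ofReal_lt _ _).symm
  · intro i _
    exact Measurable.ite (measurableSet_lt ENNReal.measurable_ofReal measurable_const)
      measurable_const measurable_const

/-- A weak-type bound of exponent `P < 1` for the weights of the large values, together with an upper
bound for the values, controls the full sum: in the layer cake integral `t ^ (-P)` is integrable
near `0`. -/
theorem sum_mul_le_of_bounded (s : Finset ι) (w b : ι → ℝ≥0∞) {P b₀ : ℝ} (hP : P < 1) (hb₀ : 0 < b₀)
    {K : ℝ≥0∞} (hb : ∀ i ∈ s, b i ≤ ENNReal.ofReal b₀)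
    (hw : ∀ t : ℝ, 0 < t → ∑ i ∈ s with ENNReal.ofReal t < b i, w i ≤ K * ENNReal.ofReal (t ^ (-P))) :
    ∑ i ∈ s, w i * b i ≤ K * ENNReal.ofReal (b₀ ^ (1 - P) / (1 - P)) := by
  have hm : Measurable fun t : ℝ => ENNReal.ofReal (t ^ (-P)) :=
    Measurable.ennreal_ofReal (by fun_prop)
  rw [sum_mul_eq_lintegral]
  calc ∫⁻ t in Ioi (0 : ℝ), ∑ i ∈ s with ENNReal.ofReal t < b i, w i
      ≤ ∫⁻ t in Ioi (0 : ℝ), (Ioo 0 b₀).indicator (fun t => K * ENNReal.ofReal (t ^ (-P))) t := by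
        refine setLIntegral_mono' measurableSet_Ioi fun t (ht : 0 < t) => ?_
        by_cases htb : t < b₀
        · rw [indicator_of_mem (show t ∈ Ioo 0 b₀ from ⟨ht, htb⟩)]
          exact hw t ht
        · rw [Finset.filter_false_of_mem]
          · simp
          · intro i hi h
            refine htb ?_
            exact (ENNReal.ofReal_lt_ofReal_iff hb₀).1 (h.trans_le (hb i hi))
    _ = ∫⁻ t in Ioo 0 b₀, K * ENNReal.ofReal (t ^ (-P)) := by
        rw [lintegral_indicator measurableSet_Ioo, Measure.restrict_restrict measurableSet_Ioo,
          inter_eq_left.2 Ioo_subset_Ioi_self]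
    _ = _ := by
        rw [lintegral_const_mul _ hm, lintegral_Ioo_rpow hb₀ (by linarith), neg_add_eq_sub]

/-- A weak-type bound of exponent `P > 1` together with a bound for the total weight controls the full
sum, as in the embedding of weak `L^P` into `L^1` on a space of finite measure. -/
theorem sum_mul_le_of_weak (s : Finset ι) (w a : ι → ℝ≥0∞) {P : ℝ} (hP : 1 < P)
    {K m : ℝ≥0∞} (hK : K ≠ ∞) (hm : m ≠ ∞) (hs : ∑ i ∈ s, w i ≤ m)
    (hw : ∀ t : ℝ, 0 < t → ∑ i ∈ s with ENNReal.ofReal t < a i, w i ≤ K * ENNReal.ofReal (t ^ (-P))) :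
    ∑ i ∈ s, w i * a i ≤ ENNReal.ofReal (P / (P - 1)) * (K ^ (1 / P) * m ^ (1 - 1 / P)) := by
  have hP0 : 0 < P := by linarith
  have hP1 : 0 < P - 1 := by linarith
  have hmeas : Measurable fun t : ℝ => ENNReal.ofReal (t ^ (-P)) :=
    Measurable.ennreal_ofReal (by fun_prop)
  rcases eq_or_ne m 0 with rfl | hm0
  · have h0 : ∀ i ∈ s, w i = 0 := Finset.sum_eq_zero_iff.1 (le_antisymm hs zero_le)
    rw [Finset.sum_eq_zero fun i hi => by rw [h0 i hi, zero_mul]]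
    exact zero_le
  rcases eq_or_ne K 0 with rfl | hK0
  · rw [sum_mul_eq_lintegral]
    refine le_trans (le_of_eq ?_) zero_le
    rw [setLIntegral_congr_fun (g := fun _ => 0) measurableSet_Ioi]
    · simp
    · intro t ht
      exact le_antisymm (by simpa using hw t ht) zero_le
  -- The layer cake integral is split at `t₀`; the optimal choice is `t₀ = (K / m) ^ (1 / P)`.
  have key : ∀ t₀ : ℝ, 0 < t₀ → ∑ i ∈ s, w i * a i ≤
      m * ENNReal.ofReal t₀ + K * ENNReal.ofReal (t₀ ^ (1 - P) / (P - 1)) := by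
    intro t₀ ht₀
    rw [sum_mul_eq_lintegral, ← Ioc_union_Ioi_eq_Ioi ht₀.le]
    refine (lintegral_union_le _ _ _).trans (add_le_add ?_ ?_)
    · calc ∫⁻ t in Ioc 0 t₀, ∑ i ∈ s with ENNReal.ofReal t < a i, w i
          ≤ ∫⁻ t in Ioc 0 t₀, m := lintegral_mono fun t =>
            (Finset.sum_le_sum_of_subset (Finset.filter_subset _ _)).trans hs
        _ = _ := by rw [setLIntegral_const, Real.volume_Ioc, sub_zero]
    · calc ∫⁻ t in Ioi t₀, ∑ i ∈ s with ENNReal.ofReal t < a i, w i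
          ≤ ∫⁻ t in Ioi t₀, K * ENNReal.ofReal (t ^ (-P)) :=
            setLIntegral_mono' measurableSet_Ioi fun t (ht : t₀ < t) => hw t (ht₀.trans ht)
        _ = _ := by
          rw [lintegral_const_mul _ hmeas, lintegral_Ioi_rpow ht₀ (by linarith)]
          congr 3
          · congr 1; ring
          · ring
  have hk : 0 < K.toReal := ENNReal.toReal_pos hK0 hK
  have hmm : 0 < m.toReal := ENNReal.toReal_pos hm0 hm
  refine (key ((K.toReal / m.toReal) ^ (1 / P)) (by positivity)).trans (le_of_eq ?_)
  rw [← ENNReal.ofReal_toReal hK, ← ENNReal.ofReal_toReal hm, ENNReal.toReal_ofReal hk.le,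
    ENNReal.toReal_ofReal hmm.le]
  set k := K.toReal
  set n := m.toReal
  rw [ENNReal.ofReal_rpow_of_pos hk, ENNReal.ofReal_rpow_of_pos hmm,
    ← ENNReal.ofReal_mul (by positivity), ← ENNReal.ofReal_mul (by positivity),
    ← ENNReal.ofReal_mul (by positivity), ← ENNReal.ofReal_mul (by positivity),
    ← ENNReal.ofReal_add (by positivity) (by positivity)]
  congr 1
  have e1 : n * (k / n) ^ (1 / P) = k ^ (1 / P) * n ^ (1 - 1 / P) := by
    rw [Real.div_rpow hk.le hmm.le, Real.rpow_sub hmm, Real.rpow_one]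
    field_simp
  have e2 : k * ((k / n) ^ (1 / P)) ^ (1 - P) = k ^ (1 / P) * n ^ (1 - 1 / P) := by
    rw [← Real.rpow_mul (by positivity)]
    have : 1 / P * (1 - P) = 1 / P - 1 := by field_simp
    rw [this, Real.rpow_sub (by positivity), Real.rpow_one, ← e1]
    field_simp
  rw [e1, mul_div_assoc', e2]
  field_simp
  ring

end WeakSums

/-! ### Dyadic cubes and sparse collections -/

section Cubes

variable {d : ℕ}

theorem Cube.measurableSet_toSet (Q : Cube d) : MeasurableSet Q.toSet := by
  have : Q.toSet = ⋂ i, {x : Rd d | x i ∈ Ico (Q.corner i) (Q.corner i + Q.side)} := by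
    ext x; simp [Cube.toSet]
  rw [this]
  refine MeasurableSet.iInter fun i => ?_
  exact measurableSet_Ico.preimage (EuclideanSpace.proj (𝕜 := ℝ) i).continuous.measurable

theorem Cube.volume_toSet (Q : Cube d) : volume Q.toSet = ENNReal.ofReal Q.side ^ d := by
  have : Q.toSet = (WithLp.ofLp : Rd d → (Fin d → ℝ)) ⁻¹'
      (univ.pi fun i => Ico (Q.corner i) (Q.corner i + Q.side)) := by
    ext x; simp [Cube.toSet]
  rw [this, (PiLp.volume_preserving_ofLp (Fin d)).measure_preimage
    (MeasurableSet.univ_pi fun _ => measurableSet_Ico).nullMeasurableSet, Real.volume_pi_Ico]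
  simp

theorem Cube.volume_toSet_ne_zero (Q : Cube d) : volume Q.toSet ≠ 0 := by
  rw [Q.volume_toSet]
  exact pow_ne_zero _ (by simpa using Q.side_pos)

theorem Cube.volume_toSet_ne_top (Q : Cube d) : volume Q.toSet ≠ ∞ := by
  rw [Q.volume_toSet]
  exact ENNReal.pow_ne_top ENNReal.ofReal_ne_top

/-- Dyadic subcubes of a common cube are nested or disjoint. -/
theorem Cube.IsDyadicSubcube.subset_of_le {P Q R : Cube d} {l m : ℕ} (hQ : Q.IsDyadicSubcube l P)
    (hR : R.IsDyadicSubcube m P) (hlm : l ≤ m) (h : (R.toSet ∩ Q.toSet).Nonempty) :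
    R.toSet ⊆ Q.toSet := by
  obtain ⟨x, hxR, hxQ⟩ := h
  obtain ⟨n, rfl⟩ := Nat.exists_eq_add_of_le hlm
  intro y hy i
  obtain ⟨k, -, hk⟩ := hQ.2 i
  obtain ⟨k', -, hk'⟩ := hR.2 i
  have h1 := hxR i
  have h2 := hxQ i
  have h3 := hy i
  rw [hk, hQ.1] at h2 ⊢
  rw [hk', hR.1] at h1 h3
  set s := P.side / 2 ^ (l + n) with hs
  have hs0 : 0 < s := div_pos P.side_pos (by positivity)
  have hs' : P.side / 2 ^ l = 2 ^ n * s := by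
    rw [hs, pow_add]; field_simp
  rw [hs'] at h2 ⊢
  simp only [mem_Ico] at h1 h2 h3 ⊢
  have e1 : (k' : ℝ) < (k + 1) * 2 ^ n := by
    refine lt_of_mul_lt_mul_right ?_ hs0.le
    nlinarith
  have e2 : (k : ℝ) * 2 ^ n < k' + 1 := by
    refine lt_of_mul_lt_mul_right ?_ hs0.le
    nlinarith
  have e3 : k' + 1 ≤ (k + 1) * 2 ^ n := by exact_mod_cast e1
  have e4 : k * 2 ^ n ≤ k' := by
    have : k * 2 ^ n < k' + 1 := by exact_mod_cast e2
    omega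
  have e5 : ((k' : ℝ) + 1) * s ≤ (k + 1) * 2 ^ n * s := by
    refine mul_le_mul_of_nonneg_right ?_ hs0.le
    exact_mod_cast e3
  have e6 : (k : ℝ) * 2 ^ n * s ≤ k' * s := by
    refine mul_le_mul_of_nonneg_right ?_ hs0.le
    exact_mod_cast e4
  constructor <;> nlinarith

theorem IsDyadicLattice.subset_of_side_le {L : Set (Cube d)} (hL : IsDyadicLattice L) {Q R : Cube d}
    (hQ : Q ∈ L) (hR : R ∈ L) (hle : R.side ≤ Q.side) (h : (R.toSet ∩ Q.toSet).Nonempty) :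
    R.toSet ⊆ Q.toSet := by
  obtain ⟨P, -, ⟨l, hl⟩, ⟨m, hm⟩⟩ := hL.ancestor Q hQ R hR
  refine hl.subset_of_le hm ?_ h
  by_contra! hml
  have := P.side_pos
  rw [hm.1, hl.1] at hle
  have h2 : P.side / 2 ^ l < P.side / 2 ^ m := by
    refine div_lt_div_of_pos_left this (by positivity) ?_
    exact pow_lt_pow_right₀ (by norm_num) hml
  linarith

/-- The weak-type estimate for the dyadic maximal function. -/
theorem IsDyadicLattice.mul_volume_iUnion_le {L : Set (Cube d)} (hL : IsDyadicLattice L)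
    (A : Finset (Cube d)) (hA : ∀ Q ∈ A, Q ∈ L) (h : Rd d → ℝ≥0∞) (θ : ℝ≥0∞)
    (hθ : ∀ Q ∈ A, θ * volume Q.toSet ≤ ∫⁻ x in Q.toSet, h x) :
    θ * volume (⋃ Q ∈ A, Q.toSet) ≤ ∫⁻ x in ⋃ Q ∈ A, Q.toSet, h x := by
  classical
  induction A using Finset.strongInduction with
  | H A ih =>
    rcases A.eq_empty_or_nonempty with rfl | hne
    · simp
    -- Split off a largest cube and all cubes inside it.
    obtain ⟨Q, hQ, hQmax⟩ := A.exists_max_image (fun Q => Q.side) hne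
    let A' := A.filter fun R => Disjoint R.toSet Q.toSet
    have hA' : A' ⊂ A := by
      refine (Finset.filter_ssubset).2 ⟨Q, hQ, fun hd => ?_⟩
      have := Q.volume_toSet_ne_zero
      rw [disjoint_self.1 hd] at this
      simp at this
    have hsplit : ⋃ R ∈ A, R.toSet = Q.toSet ∪ ⋃ R ∈ A', R.toSet := by
      ext x
      simp only [mem_iUnion, exists_prop, mem_union, A', Finset.mem_filter]
      constructor
      · rintro ⟨R, hR, hx⟩
        by_cases hd : Disjoint R.toSet Q.toSet
        · exact Or.inr ⟨R, ⟨hR, hd⟩, hx⟩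
        · exact Or.inl (hL.subset_of_side_le (hA Q hQ) (hA R hR) (hQmax R hR)
            (not_disjoint_iff_nonempty_inter.1 hd) hx)
      · rintro (hx | ⟨R, ⟨hR, -⟩, hx⟩)
        · exact ⟨Q, hQ, hx⟩
        · exact ⟨R, hR, hx⟩
    have hm : MeasurableSet (⋃ R ∈ A', R.toSet) :=
      Finset.measurableSet_biUnion _ fun R _ => R.measurableSet_toSet
    have hd : Disjoint Q.toSet (⋃ R ∈ A', R.toSet) := by
      simp only [disjoint_iUnion_right]
      exact fun R hR => (Finset.mem_filter.1 hR).2.symm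
    rw [hsplit, measure_union hd hm, lintegral_union hm hd, mul_add]
    refine add_le_add (hθ Q hQ) (ih A' hA' (fun R hR => hA R (hA'.1 hR)) fun R hR => hθ R (hA'.1 hR))

/-- The disjoint sets `E_Q` turn a sum of volumes into the volume of a union. -/
theorem IsSparse.sum_volume_le {γ : ℝ} (hγ : 0 < γ) {S : Set (Cube d)} (hS : IsSparse γ S)
    (A : Finset (Cube d)) (hA : ∀ Q ∈ A, Q ∈ S) :
    ∑ Q ∈ A, volume Q.toSet ≤ (ENNReal.ofReal γ)⁻¹ * volume (⋃ Q ∈ A, Q.toSet) := by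
  obtain ⟨E, hE, hd⟩ := hS
  have hγ0 : ENNReal.ofReal γ ≠ 0 := by simpa using hγ
  calc ∑ Q ∈ A, volume Q.toSet ≤ ∑ Q ∈ A, (ENNReal.ofReal γ)⁻¹ * volume (E Q) := by
        refine Finset.sum_le_sum fun Q hQ => ?_
        rw [← ENNReal.mul_le_iff_le_inv hγ0 ENNReal.ofReal_ne_top]
        exact (hE Q (hA Q hQ)).2.2
    _ = (ENNReal.ofReal γ)⁻¹ * volume (⋃ Q ∈ A, E Q) := by
        rw [← Finset.mul_sum, measure_biUnion_finset₀]
        · exact fun Q hQ R hR hne => (hd (hA Q hQ) (hA R hR) hne).aedisjoint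
        · exact fun Q hQ => (hE Q (hA Q hQ)).1
    _ ≤ _ := by
        gcongr with Q hQ
        exact (hE Q (hA Q hQ)).2.1

/-- The total volume of the cubes of a sparse collection on which the average of `h` is at least
`t ^ P`. -/
theorem IsSparse.sum_volume_le_lintegral {γ : ℝ} (hγ : 0 < γ) {L S : Set (Cube d)}
    (hL : IsDyadicLattice L) (hSL : S ⊆ L) (hS : IsSparse γ S)
    (A : Finset (Cube d)) (hA : ∀ Q ∈ A, Q ∈ S) (h : Rd d → ℝ≥0∞) {P t : ℝ} (ht : 0 < t)
    (hP : 0 < P)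
    (hθ : ∀ Q ∈ A, ENNReal.ofReal t ≤ ((volume Q.toSet)⁻¹ * ∫⁻ x in Q.toSet, h x) ^ (1 / P)) :
    ∑ Q ∈ A, volume Q.toSet ≤
      (ENNReal.ofReal γ)⁻¹ * (∫⁻ x, h x) * ENNReal.ofReal (t ^ (-P)) := by
  have htP : 0 < t ^ P := Real.rpow_pos_of_pos ht P
  have h1 : ENNReal.ofReal (t ^ P) * volume (⋃ Q ∈ A, Q.toSet) ≤ ∫⁻ x, h x := by
    refine (hL.mul_volume_iUnion_le A (fun Q hQ => hSL (hA Q hQ)) h _ fun Q hQ => ?_).trans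
      (setLIntegral_le_lintegral _ _)
    have h2 := ENNReal.rpow_le_rpow (hθ Q hQ) hP.le
    rw [← ENNReal.rpow_mul, one_div_mul_cancel hP.ne', ENNReal.rpow_one,
      ENNReal.ofReal_rpow_of_pos ht] at h2
    rw [mul_comm (ENNReal.ofReal _), ENNReal.mul_le_iff_le_inv Q.volume_toSet_ne_zero
      Q.volume_toSet_ne_top]
    exact h2
  calc ∑ Q ∈ A, volume Q.toSet ≤ (ENNReal.ofReal γ)⁻¹ * volume (⋃ Q ∈ A, Q.toSet) :=
        hS.sum_volume_le hγ A hA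
    _ ≤ (ENNReal.ofReal γ)⁻¹ * ((ENNReal.ofReal (t ^ P))⁻¹ * ∫⁻ x, h x) := by
        gcongr
        rwa [← ENNReal.mul_le_iff_le_inv (by simpa using htP) ENNReal.ofReal_ne_top]
    _ = _ := by
        rw [Real.rpow_neg ht.le, ENNReal.ofReal_inv_of_pos htP]
        ring

end Cubes

/-! ### Estimates for the maximal form -/

section Forms

variable {d : ℕ} {B C : Type*} [NormedAddCommGroup B] [NormedAddCommGroup C]

theorem sparseForm_le {S : Set (Cube d)} {p₁ p₂ : ℝ} {f₁ : Rd d → B} {f₂ : Rd d → C} {M : ℝ≥0∞}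
    (h : ∀ A : Finset (Cube d), (∀ Q ∈ A, Q ∈ S) →
      ∑ Q ∈ A, volume Q.toSet * cubeAvg p₁ Q f₁ * cubeAvg p₂ Q f₂ ≤ M) :
    sparseForm S p₁ p₂ f₁ f₂ ≤ M := by
  rw [sparseForm, ENNReal.tsum_eq_iSup_sum]
  refine iSup_le fun s => ?_
  have := h (s.map (Function.Embedding.subtype _)) (by
    intro Q hQ
    obtain ⟨R, -, rfl⟩ := Finset.mem_map.1 hQ
    exact R.2)
  rw [Finset.sum_map] at this
  exact this

theorem maximalForm_comm (L : Set (Cube d)) (γ p₁ p₂ : ℝ) (f₁ : Rd d → B) (f₂ : Rd d → C) :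
    maximalForm L γ p₁ p₂ f₁ f₂ = maximalForm L γ p₂ p₁ f₂ f₁ := by
  simp only [maximalForm, sparseForm, mul_right_comm]

/-- The maximal form obeys a bound of restricted type: one function is arbitrary in `L^p`, the other is
bounded by `M` times an indicator function. Both averages `⟨f₁⟩_{Q,p}` and `⟨1_E⟩_{Q,r}` satisfy weak-type
bounds with respect to the weights `|Q|`. The cubes with `⟨1_E⟩_{Q,r} > t` have total volume of order
`t ^ (-r) |E|`, so the sum of `|Q| ⟨f₁⟩_{Q,p}` over them is of order
`‖f₁‖_p |E| ^ (1 - 1 / p) t ^ (-r (1 - 1 / p))`, which is integrable over `0 < t < 1`. -/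
theorem maximalForm_le_of_le_indicator {L : Set (Cube d)} (hL : IsDyadicLattice L) {γ p r : ℝ}
    (hγ : 0 < γ) (hp : 1 < p) (hr : 0 < r) (hpr : r * (1 - 1 / p) < 1) (f₁ : Rd d → B) (f₂ : Rd d → C)
    (hf₁ : ∫⁻ x, ‖f₁ x‖ₑ ^ p ≠ ∞) {E : Set (Rd d)} (hE : volume E ≠ ∞) {M : ℝ≥0∞}
    (hM : M ≠ ∞) (hf₂ : ∀ x, ‖f₂ x‖ₑ ≤ M * E.indicator 1 x) :
    maximalForm L γ p r f₁ f₂ ≤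
      ENNReal.ofReal (p / (p - 1) * γ⁻¹ * (1 - r * (1 - 1 / p))⁻¹) *
        (M * (∫⁻ x, ‖f₁ x‖ₑ ^ p) ^ (1 / p) * volume E ^ (1 - 1 / p)) := by
  have hp0 : 0 < p := by linarith
  have hp1 : 0 < p - 1 := by linarith
  have hpp : 0 < 1 - 1 / p := by rw [sub_pos, div_lt_one hp0]; exact hp
  have hg0 : ENNReal.ofReal γ ≠ 0 := by simpa using hγ
  have hgt : (ENNReal.ofReal γ)⁻¹ ≠ ∞ := ENNReal.inv_ne_top.2 hg0
  set F := ∫⁻ x, ‖f₁ x‖ₑ ^ p with hF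
  refine iSup_le fun S => iSup₂_le fun hSL hS => sparseForm_le fun A hA => ?_
  let h : Rd d → ℝ≥0∞ := E.indicator 1
  have hh : ∫⁻ x, h x ≤ volume E := by
    exact (lintegral_indicator_const_le (μ := volume) E 1).trans (by simp)
  let e : Cube d → ℝ≥0∞ := fun Q => ((volume Q.toSet)⁻¹ * ∫⁻ x in Q.toSet, h x) ^ (1 / r)
  have he1 : ∀ Q, e Q ≤ ENNReal.ofReal 1 := by
    intro Q
    rw [ENNReal.ofReal_one]
    refine ENNReal.rpow_le_one ?_ (by positivity)
    rw [← ENNReal.inv_mul_cancel Q.volume_toSet_ne_zero Q.volume_toSet_ne_top]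
    gcongr
    calc ∫⁻ x in Q.toSet, h x ≤ ∫⁻ x in Q.toSet, 1 := by
          refine lintegral_mono fun x => ?_
          exact indicator_le_self' (fun _ _ => zero_le) x
      _ = _ := by simp
  have hf₂e : ∀ Q, cubeAvg r Q f₂ ≤ M * e Q := by
    intro Q
    have h1 : M = (M ^ r) ^ (1 / r) := by
      rw [← ENNReal.rpow_mul, mul_one_div_cancel hr.ne', ENNReal.rpow_one]
    have h2 : ∀ x, ‖f₂ x‖ₑ ^ r ≤ M ^ r * h x := by
      intro x
      refine (ENNReal.rpow_le_rpow (hf₂ x) hr.le).trans ?_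
      rw [ENNReal.mul_rpow_of_nonneg _ _ hr.le]
      gcongr
      by_cases hx : x ∈ E <;> simp [h, hx, hr]
    simp only [cubeAvg, e]
    rw [h1, ← ENNReal.mul_rpow_of_nonneg _ _ (by positivity : (0 : ℝ) ≤ 1 / r)]
    rw [mul_left_comm, ← lintegral_const_mul' _ _ (ENNReal.rpow_ne_top_of_nonneg hr.le hM)]
    gcongr with x
    exact h2 x
  calc ∑ Q ∈ A, volume Q.toSet * cubeAvg p Q f₁ * cubeAvg r Q f₂
      ≤ ∑ Q ∈ A, M * (volume Q.toSet * cubeAvg p Q f₁ * e Q) := by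
        refine Finset.sum_le_sum fun Q _ => ?_
        rw [mul_left_comm M]
        gcongr
        exact hf₂e Q
    _ = M * ∑ Q ∈ A, volume Q.toSet * cubeAvg p Q f₁ * e Q := by rw [Finset.mul_sum]
    _ ≤ M * (ENNReal.ofReal (p / (p - 1)) * (ENNReal.ofReal γ)⁻¹ * F ^ (1 / p) *
          volume E ^ (1 - 1 / p) *
          ENNReal.ofReal (1 ^ (1 - r * (1 - 1 / p)) / (1 - r * (1 - 1 / p)))) := by
        gcongr
        refine sum_mul_le_of_bounded A _ e hpr one_pos (fun Q _ => he1 Q) fun t ht => ?_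
        have hm : ∑ Q ∈ A with ENNReal.ofReal t < e Q, volume Q.toSet ≤
            (ENNReal.ofReal γ)⁻¹ * volume E * ENNReal.ofReal (t ^ (-r)) := by
          refine (hS.sum_volume_le_lintegral hγ hL hSL _ (fun Q hQ => hA Q (Finset.mem_filter.1 hQ).1)
            h ht hr fun Q hQ => (Finset.mem_filter.1 hQ).2.le).trans ?_
          gcongr
        refine (sum_mul_le_of_weak _ _ _ hp (K := (ENNReal.ofReal γ)⁻¹ * F)
          (ENNReal.mul_ne_top hgt hf₁) (ENNReal.mul_ne_top (ENNReal.mul_ne_top hgt hE)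
            ENNReal.ofReal_ne_top) hm fun s hs => ?_).trans (le_of_eq ?_)
        · exact hS.sum_volume_le_lintegral hγ hL hSL _
            (fun Q hQ => hA Q (Finset.mem_filter.1 (Finset.mem_filter.1 hQ).1).1)
            _ hs hp0 fun Q hQ => (Finset.mem_filter.1 hQ).2.le
        · rw [ENNReal.mul_rpow_of_nonneg _ _ (by positivity : (0 : ℝ) ≤ 1 / p),
            ENNReal.mul_rpow_of_nonneg _ _ hpp.le, ENNReal.mul_rpow_of_nonneg _ _ hpp.le,
            ENNReal.ofReal_rpow_of_pos (Real.rpow_pos_of_pos ht _), ← Real.rpow_mul ht.le, neg_mul]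
          have : (ENNReal.ofReal γ)⁻¹ ^ (1 / p) * (ENNReal.ofReal γ)⁻¹ ^ (1 - 1 / p) =
              (ENNReal.ofReal γ)⁻¹ := by
            rw [← ENNReal.rpow_add _ _ (by simp) hgt]; simp
          nth_rewrite 3 [← this]
          ring
    _ = _ := by
        rw [Real.one_rpow, one_div (1 - _), ENNReal.ofReal_mul (by positivity),
          ENNReal.ofReal_mul (by positivity), ENNReal.ofReal_inv_of_pos hγ]
        ring

end Forms

/-! ### Lorentz space bounds from sparse domination -/

section Endpoint

variable {d : ℕ} {𝕜 : Type*} [RCLike 𝕜]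
  {B₁ : Type*} [NormedAddCommGroup B₁] [NormedSpace 𝕜 B₁]
  {B₂ : Type*} [NormedAddCommGroup B₂] [NormedSpace 𝕜 B₂]

theorem exists_bound_of_mem_simpleSpace {f : Rd d → B₁} (hf : f ∈ simpleSpace d 𝕜 B₁) :
    ∃ M : ℝ≥0∞, M ≠ ∞ ∧ ∀ x, ‖f x‖ₑ ≤ M := by
  obtain ⟨M, hM⟩ := (hf.1.image fun b => ‖b‖₊).bddAbove
  exact ⟨M, ENNReal.coe_ne_top, fun x => ENNReal.coe_le_coe.2 (hM ⟨f x, ⟨x, rfl⟩, rfl⟩)⟩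

theorem lintegral_rpow_ne_top_of_mem_simpleSpace {f : Rd d → B₁} (hf : f ∈ simpleSpace d 𝕜 B₁)
    {p : ℝ} (hp : 0 < p) : ∫⁻ x, ‖f x‖ₑ ^ p ≠ ∞ := by
  obtain ⟨M, hMt, hM⟩ := exists_bound_of_mem_simpleSpace hf
  refine ne_top_of_le_ne_top ?_ ((lintegral_mono fun x => ?_).trans
    (lintegral_indicator_const_le (μ := volume) (tsupport f) (M ^ p)))
  · exact ENNReal.mul_ne_top (ENNReal.rpow_ne_top_of_nonneg hp.le hMt)
      (IsCompact.measure_lt_top hf.2.2).ne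
  · by_cases hx : x ∈ tsupport f
    · rw [indicator_of_mem hx]
      exact ENNReal.rpow_le_rpow (hM x) hp.le
    · simp [image_eq_zero_of_notMem_tsupport hx, hp]

/-- The factor `1` matches the shape `M * E.indicator 1 x` in `maximalForm_le_of_le_indicator`. -/
theorem enorm_le_indicator {f : Rd d → B₁} {E : Set (Rd d)} (h : ∀ x, ‖f x‖ ≤ E.indicator 1 x) (x : Rd d) :
    ‖f x‖ₑ ≤ 1 * E.indicator 1 x := by
  rw [← ofReal_norm, one_mul]
  refine (ENNReal.ofReal_le_ofReal (h x)).trans ?_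
  by_cases hx : x ∈ E <;> simp [hx]

theorem IsOp.sum {T : ℤ → simpleSpace d 𝕜 B₁ →ₗ[𝕜] (Rd d → B₂)} (hT : ∀ j, IsOp (T j)) (s : Finset ℤ) :
    IsOp (∑ j ∈ s, T j) := by
  intro f l
  have : (fun x => l ((∑ j ∈ s, T j) f x)) = fun x => ∑ j ∈ s, l (T j f x) := by
    ext x
    simp [LinearMap.sum_apply, Finset.sum_apply]
  rw [this]
  exact locallyIntegrable_finsetSum s fun j _ => hT j f l

variable {L : Set (Cube d)} {p q γ C : ℝ} {T : simpleSpace d 𝕜 B₁ →ₗ[𝕜] (Rd d → B₂)}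

/-- The constant of the restricted bound `maximalForm_le_of_le_indicator`. -/
noncomputable def formConst (p r γ : ℝ) : ℝ := p / (p - 1) * γ⁻¹ * (1 - r * (1 - 1 / p))⁻¹

theorem formConst_pos {p r γ : ℝ} (hp : 1 < p) (hγ : 0 < γ) (h : r * (1 - 1 / p) < 1) :
    0 < formConst p r γ := by
  have : 0 < p - 1 := by linarith
  have : 0 < 1 - r * (1 - 1 / p) := by linarith
  unfold formConst
  positivity

/-- The exponent condition of `maximalForm_le_of_le_indicator` for `f₁` in `L^p` and `f₂` bounded; this is
where `p < q` enters. -/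
theorem exponent_lt_one (hp : 1 < p) (hpq : p < q) : q / (q - 1) * (1 - 1 / p) < 1 := by
  have h1 : 0 < p := by linarith
  have h2 : 0 < q - 1 := by linarith
  rw [div_mul_eq_mul_div, div_lt_one h2]
  have : q / p > 1 := by rw [gt_iff_lt, one_lt_div h1]; exact hpq
  have e : q * (1 - 1 / p) = q - q / p := by ring
  rw [e]
  linarith

/-- The exponent condition of `maximalForm_le_of_le_indicator` with the roles of the two functions
exchanged. -/
theorem exponent_lt_one' (hp : 1 < p) (hpq : p < q) : p * (1 - 1 / (q / (q - 1))) < 1 := by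
  have h1 : 0 < q := by linarith
  have h2 : 0 < q - 1 := by linarith
  have e : p * (1 - 1 / (q / (q - 1))) = p / q := by field_simp; ring
  rw [e, div_lt_one h1]
  exact hpq

theorem SparseBound.enorm_pairing_le (hL : IsDyadicLattice L) (hγ : 0 < γ) (hp : 1 < p) (hpq : p < q)
    (hT : SparseBound L γ p (q / (q - 1)) C T) (hC : 0 < C) (f : simpleSpace d 𝕜 B₁)
    (f₂ : simpleSpace d 𝕜 (StrongDual 𝕜 B₂)) {E : Set (Rd d)} (hE : volume E ≠ ∞)
    (hf₂ : ∀ x, ‖f₂.1 x‖ ≤ E.indicator 1 x) :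
    ‖pairing (T f) f₂.1‖ₑ ≤ ENNReal.ofReal (C * formConst p (q / (q - 1)) γ) *
      (∫⁻ x, ‖f.1 x‖ₑ ^ p) ^ (1 / p) * volume E ^ (1 - 1 / p) := by
  have hp0 : 0 < p := by linarith
  have hq : 0 < q / (q - 1) := div_pos (by linarith) (by linarith)
  have h1 := maximalForm_le_of_le_indicator hL hγ hp hq (exponent_lt_one hp hpq) f.1 f₂.1
    (lintegral_rpow_ne_top_of_mem_simpleSpace f.2 hp0) hE ENNReal.one_ne_top
    (enorm_le_indicator hf₂)
  refine (hT f f₂).trans ((mul_le_mul_right h1 _).trans (le_of_eq ?_))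
  rw [formConst, ENNReal.ofReal_mul hC.le]
  ring

theorem SparseBound.exists_representative [CompleteSpace B₂] (hB : IsReflexive 𝕜 B₂) (hL : IsDyadicLattice L)
    (hγ : 0 < γ) (hp : 1 < p) (hpq : p < q) (hop : IsOp T)
    (hT : SparseBound L γ p (q / (q - 1)) C T) (hC : 0 < C) (f : simpleSpace d 𝕜 B₁) :
    ∃ g : Rd d → B₂, AEStronglyMeasurable g volume ∧ WeakEq 𝕜 (T f) g ∧
      ∀ (φ : simpleSpace d ℝ ℝ) (K : ℝ≥0∞), (∀ x, 0 ≤ (φ : Rd d → ℝ) x) →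
        (∀ f₂ : simpleSpace d 𝕜 (StrongDual 𝕜 B₂),
          (∀ x, ‖(f₂ : Rd d → StrongDual 𝕜 B₂) x‖ ≤ (φ : Rd d → ℝ) x) → ‖pairing (T f) f₂.1‖ₑ ≤ K) →
        ∫⁻ x, ENNReal.ofReal ((φ : Rd d → ℝ) x) * ‖g x‖ₑ ≤ K := by
  have hp0 : 0 < p := by linarith
  have hpp : 0 < 1 - 1 / p := by rw [sub_pos, div_lt_one hp0]; exact hp
  refine exists_strong_representative hB (hop f) fun R => ⟨_, ?_, fun f₂ hf₂ =>
    hT.enorm_pairing_le hL hγ hp hpq hC f f₂ measure_closedBall_lt_top.ne hf₂⟩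
  refine ENNReal.mul_ne_top (ENNReal.mul_ne_top ENNReal.ofReal_ne_top ?_) ?_
  · exact ENNReal.rpow_ne_top_of_nonneg (by positivity)
      (lintegral_rpow_ne_top_of_mem_simpleSpace f.2 hp0)
  · exact ENNReal.rpow_ne_top_of_nonneg hpp.le measure_closedBall_lt_top.ne

/-- The bound `L^p → L^{p,∞}`. The restricted bound of the form on simple functions dominated by `1_E`
gives `∫_E ‖g‖ ≲ ‖f‖_p |E| ^ (1 - 1 / p)` for the representative `g` of `T f`. -/
theorem SparseBound.weakLorentz [CompleteSpace B₂] (hB : IsReflexive 𝕜 B₂) (hL : IsDyadicLattice L)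
    (hγ : 0 < γ) (hp : 1 < p) (hpq : p < q) (hop : IsOp T)
    (hT : SparseBound L γ p (q / (q - 1)) C T) (hC : 0 < C) :
    OpNormLE T (lebesgueNorm p) (weakLorentzNorm p)
      (p / (p - 1) * formConst p (q / (q - 1)) γ * C) := by
  intro f
  have hp0 : 0 < p := by linarith
  have hp1 : 0 < p - 1 := by linarith
  have hc := formConst_pos hp hγ (exponent_lt_one hp hpq)
  obtain ⟨g, hg, hTg, hφ⟩ := hT.exists_representative hB hL hγ hp hpq hop hC f
  refine ⟨g, hg, hTg, ?_⟩
  have hfin : (∫⁻ x, ‖f.1 x‖ₑ ^ p) ^ (1 / p) ≠ ∞ :=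
    ENNReal.rpow_ne_top_of_nonneg (by positivity) (lintegral_rpow_ne_top_of_mem_simpleSpace f.2 hp0)
  refine (weakLorentzNorm_le hp hg (K := ENNReal.ofReal (C * formConst p (q / (q - 1)) γ) *
      (∫⁻ x, ‖f.1 x‖ₑ ^ p) ^ (1 / p)) (ENNReal.mul_ne_top ENNReal.ofReal_ne_top hfin)
      fun E hE hEb => ?_).trans (le_of_eq ?_)
  · have hEt : volume E ≠ ∞ := hEb.measure_lt_top.ne
    have h1 := hφ ⟨E.indicator fun _ => 1, indicator_const_mem_simpleSpace hE
      hEb.isCompact_closure subset_closure 1⟩ _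
      (fun x => indicator_nonneg (fun _ _ => zero_le_one) x)
      fun f₂ hf₂ => hT.enorm_pairing_le hL hγ hp hpq hC f f₂ hEt hf₂
    refine le_trans (le_of_eq ?_) h1
    rw [← lintegral_indicator₀ hE]
    refine lintegral_congr fun x => ?_
    by_cases hx : x ∈ E <;> simp [hx]
  · rw [lebesgueNorm_eq hp0, ← mul_assoc, ← ENNReal.ofReal_mul (by positivity)]
    congr 2
    ring

theorem coe_two_zpow (k : ℤ) : (2 : ℝ≥0∞) ^ k = (((2 : NNReal) ^ k : NNReal) : ℝ≥0∞) := by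
  rw [ENNReal.coe_zpow two_ne_zero, ENNReal.coe_ofNat]

theorem two_zpow_log_le_enorm {b : B₁} (hb : b ≠ 0) : (2 : ℝ≥0∞) ^ Int.log 2 ‖b‖ ≤ ‖b‖ₑ := by
  rw [coe_two_zpow, enorm_eq_nnnorm, ENNReal.coe_le_coe, ← NNReal.coe_le_coe]
  push_cast
  exact_mod_cast Int.zpow_log_le_self (b := 2) one_lt_two (norm_pos_iff.2 hb)

theorem enorm_le_two_mul_two_zpow_log (b : B₁) : ‖b‖ₑ ≤ 2 * (2 : ℝ≥0∞) ^ Int.log 2 ‖b‖ := by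
  have h := (Int.lt_zpow_succ_log_self (b := 2) one_lt_two ‖b‖).le
  rw [zpow_add₀ (by norm_num), zpow_one, mul_comm] at h
  rw [coe_two_zpow, enorm_eq_nnnorm, ← ENNReal.coe_ofNat, ← ENNReal.coe_mul, ENNReal.coe_le_coe,
    ← NNReal.coe_le_coe]
  push_cast
  exact_mod_cast h

theorem pairing_sum {ι : Type*} (s : Finset ι) (F : ι → Rd d → B₂)
    (hF : ∀ i, ∀ l : StrongDual 𝕜 B₂, LocallyIntegrable (fun x => l (F i x)) volume)
    (f₂ : simpleSpace d 𝕜 (StrongDual 𝕜 B₂)) :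
    pairing (∑ i ∈ s, F i) f₂.1 = ∑ i ∈ s, pairing (F i) f₂.1 := by
  simp only [pairing, Finset.sum_apply, map_sum]
  exact integral_finsetSum _ fun i _ => integrable_pairing (hF i) f₂

/-- The bound `L^{q,1} → L^q`. The dyadic layers of `f` are bounded by multiples of indicator functions,
and their contributions add up to the norm of `L^{q,1}`. -/
theorem SparseBound.lorentzOne [CompleteSpace B₂] (hB : IsReflexive 𝕜 B₂) (hL : IsDyadicLattice L)
    (hγ : 0 < γ) (hp : 1 < p) (hpq : p < q) (hop : IsOp T)
    (hT : SparseBound L γ p (q / (q - 1)) C T) (hC : 0 < C) :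
    OpNormLE T (lorentzOneNorm q) (lebesgueNorm q)
      (4 * formConst (q / (q - 1)) p γ * C) := by
  classical
  intro f
  have hq : 1 < q := hp.trans hpq
  have hq0 : 0 < q := by linarith
  have hq1 : 0 < q - 1 := by linarith
  have hq' : 1 < q / (q - 1) := by rw [one_lt_div hq1]; linarith
  have hq'0 : 0 < q / (q - 1) := by positivity
  have hc := formConst_pos hq' hγ (exponent_lt_one' hp hpq)
  obtain ⟨g, hg, hTg, hφ⟩ := hT.exists_representative hB hL hγ hp hpq hop hC f
  refine ⟨g, hg, hTg, ?_⟩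
  rw [lebesgueNorm_eq hq0]
  refine lintegral_rpow_le_of_simple hq hg.enorm fun φ h0 => hφ φ _ h0 fun f₂ hf₂ => ?_
  -- The dyadic layers of `f`.
  let E : ℤ → Set (Rd d) := fun k => {x | f.1 x ≠ 0 ∧ Int.log 2 ‖f.1 x‖ = k}
  have hEm : ∀ k, NullMeasurableSet (E k) volume := by
    intro k
    have : E k = ⋃ b ∈ range f.1 ∩ {b | b ≠ 0 ∧ Int.log 2 ‖b‖ = k}, f.1 ⁻¹' {b} := by
      ext x; simp [E]
    rw [this]
    exact NullMeasurableSet.biUnion (f.2.1.countable.mono inter_subset_left) fun b _ => f.2.2.1 b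
  have hEs : ∀ k, E k ⊆ tsupport f.1 := fun k x hx => subset_tsupport _ hx.1
  have hEt : ∀ k, volume (E k) ≠ ∞ := fun k =>
    ((measure_mono (hEs k)).trans_lt (IsCompact.measure_lt_top f.2.2.2)).ne
  let fk : ℤ → simpleSpace d 𝕜 B₁ := fun k => ⟨(E k).indicator f.1, indicator_mem_simpleSpace f.2 (hEm k)⟩
  let s : Finset ℤ := f.2.1.toFinset.image fun b => Int.log 2 ‖b‖
  have hsum : f = ∑ k ∈ s, fk k := by
    apply Subtype.ext
    ext x
    simp only [Submodule.coe_sum, Finset.sum_apply, fk]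
    by_cases hx : f.1 x = 0
    · rw [hx, Finset.sum_eq_zero]
      intro k _
      by_cases h : x ∈ E k <;> simp [h, hx]
    · rw [Finset.sum_eq_single (Int.log 2 ‖f.1 x‖)]
      · rw [indicator_of_mem (show x ∈ E _ from ⟨hx, rfl⟩)]
      · intro k _ hk
        exact indicator_of_notMem (fun h => hk h.2.symm) _
      · intro h
        exact absurd (Finset.mem_image.2 ⟨f.1 x, by simp, rfl⟩) h
  have hlayer : ∀ k, ‖pairing (T (fk k)) f₂.1‖ₑ ≤ ENNReal.ofReal (C * formConst (q / (q - 1)) p γ) *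
      (2 * (2 : ℝ≥0∞) ^ k * (∫⁻ x, ‖f₂.1 x‖ₑ ^ (q / (q - 1))) ^ (1 / (q / (q - 1))) *
        volume (E k) ^ (1 / q)) := by
    intro k
    have h1 := maximalForm_le_of_le_indicator hL hγ hq' (by linarith : 0 < p) (exponent_lt_one' hp hpq)
      f₂.1 (fk k).1 (lintegral_rpow_ne_top_of_mem_simpleSpace f₂.2 hq'0) (hEt k)
      (M := 2 * (2 : ℝ≥0∞) ^ k)
      (ENNReal.mul_ne_top (by simp) (ENNReal.zpow_ne_top (by simp) (by simp) k)) (fun x => by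
        by_cases hx : x ∈ E k
        · simp only [fk, indicator_of_mem hx, Pi.one_apply, mul_one]
          rw [← hx.2]
          exact enorm_le_two_mul_two_zpow_log _
        · simp [fk, indicator_of_notMem hx])
    refine (hT (fk k) f₂).trans ?_
    rw [maximalForm_comm]
    refine (mul_le_mul_right h1 _).trans (le_of_eq ?_)
    have e : 1 - 1 / (q / (q - 1)) = 1 / q := by field_simp; ring
    rw [formConst, ENNReal.ofReal_mul hC.le, e]
    ring
  have hpair : pairing (T f) f₂.1 = ∑ k ∈ s, pairing (T (fk k)) f₂.1 := by
    rw [← pairing_sum s (fun k => T (fk k)) (fun k => hop (fk k)) f₂, ← map_sum, ← hsum]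
  set N := (∫⁻ x, ‖f₂.1 x‖ₑ ^ (q / (q - 1))) ^ (1 / (q / (q - 1))) with hN
  calc ‖pairing (T f) f₂.1‖ₑ ≤ ∑ k ∈ s, ‖pairing (T (fk k)) f₂.1‖ₑ := by
        rw [hpair]; exact enorm_sum_le _ _
    _ ≤ ∑ k ∈ s, ENNReal.ofReal (C * formConst (q / (q - 1)) p γ) *
          (2 * (2 : ℝ≥0∞) ^ k * N * volume (E k) ^ (1 / q)) := Finset.sum_le_sum fun k _ => hlayer k
    _ = ENNReal.ofReal (C * formConst (q / (q - 1)) p γ) * 2 * N *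
          ∑ k ∈ s, (2 : ℝ≥0∞) ^ k * volume (E k) ^ (1 / q) := by
        rw [Finset.mul_sum]
        exact Finset.sum_congr rfl fun k _ => by ring
    _ ≤ ENNReal.ofReal (C * formConst (q / (q - 1)) p γ) * 2 * N * (2 * lorentzOneNorm q f.1) := by
        gcongr
        refine sum_two_zpow_mul_le_lorentzOneNorm hq f.1 s E hEt fun k x hx => ?_
        rw [← hx.2]
        exact two_zpow_log_le_enorm hx.1
    _ = ENNReal.ofReal (4 * formConst (q / (q - 1)) p γ * C) * lorentzOneNorm q f.1 * N := by
        have e : (4 : ℝ) * formConst (q / (q - 1)) p γ * C = C * formConst (q / (q - 1)) p γ * 4 := by ring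
        rw [e, ENNReal.ofReal_mul (by positivity) (q := 4), ENNReal.ofReal_ofNat]
        ring
    _ ≤ _ := by
        gcongr ENNReal.ofReal _ * _ * ?_
        refine ENNReal.rpow_le_rpow (lintegral_mono fun x => ?_) (by positivity)
        refine ENNReal.rpow_le_rpow ?_ hq'0.le
        rw [← ofReal_norm]
        exact ENNReal.ofReal_le_ofReal (hf₂ x)

end Endpoint

/-! ### Separated supports -/

section Separated

variable {d : ℕ}

theorem dist_le_of_coord {x y : Rd d} {s : ℝ} (hs : 0 ≤ s) (h : ∀ i, |x i - y i| ≤ s) :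
    dist x y ≤ √d * s := by
  rw [EuclideanSpace.dist_eq]
  refine Real.sqrt_le_iff.2 ⟨by positivity, ?_⟩
  rw [mul_pow, Real.sq_sqrt (Nat.cast_nonneg d)]
  calc ∑ i, dist (x i) (y i) ^ 2 ≤ ∑ _i : Fin d, s ^ 2 := by
        refine Finset.sum_le_sum fun i _ => ?_
        rw [Real.dist_eq]
        gcongr
        exact h i
    _ = _ := by simp

theorem Cube.dist_le {Q : Cube d} {x y : Rd d} (hx : x ∈ Q.toSet) (hy : y ∈ Q.toSet) :
    dist x y ≤ √d * Q.side := by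
  refine dist_le_of_coord Q.side_pos.le fun i => ?_
  have h1 := hx i
  have h2 := hy i
  simp only [mem_Ico] at h1 h2
  rw [abs_le]
  constructor <;> linarith

theorem cubeAvg_eq_zero {B : Type*} [NormedAddCommGroup B] {p : ℝ} (hp : 0 < p) {Q : Cube d}
    {f : Rd d → B} {A : Set (Rd d)} (hf : ∀ᵐ x ∂(volume : Measure (Rd d)), x ∉ A → f x = 0)
    (h : Disjoint Q.toSet A) : cubeAvg p Q f = 0 := by
  have : ∫⁻ x in Q.toSet, ‖f x‖ₑ ^ p = 0 := by
    rw [setLIntegral_congr_fun_ae (g := fun _ => 0) Q.measurableSet_toSet]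
    · simp
    · filter_upwards [hf] with x hx hxQ
      simp [hx (disjoint_left.1 h hxQ), hp]
  rw [cubeAvg, this, mul_zero, ENNReal.zero_rpow_of_pos (by positivity)]

theorem cubeAvg_le {B : Type*} [NormedAddCommGroup B] {p : ℝ} (hp : 0 < p) (Q : Cube d) (f : Rd d → B) :
    cubeAvg p Q f ≤ ENNReal.ofReal (Q.side ^ (-(d : ℝ) / p)) * (∫⁻ x, ‖f x‖ₑ ^ p) ^ (1 / p) := by
  have hs := Q.side_pos
  have h1 : (volume Q.toSet)⁻¹ ^ (1 / p) = ENNReal.ofReal (Q.side ^ (-(d : ℝ) / p)) := by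
    rw [Q.volume_toSet, ← ENNReal.ofReal_pow hs.le, ← ENNReal.ofReal_inv_of_pos (by positivity),
      ENNReal.ofReal_rpow_of_pos (by positivity), ← Real.rpow_natCast, ← Real.rpow_neg hs.le,
      ← Real.rpow_mul hs.le]
    congr 2
    ring
  rw [cubeAvg, ENNReal.mul_rpow_of_nonneg _ _ (by positivity), h1]
  exact mul_le_mul_right (ENNReal.rpow_le_rpow (setLIntegral_le_lintegral _ _) (by positivity)) _

/-- If the supports of `f₁` and `f₂` have distance at least `ρ` and the first one lies in a ball of
radius `ρ`, then only cubes of side length at least of order `ρ` that are close to this ball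
contribute to the maximal form. Bounding each average by the full norm leaves the sum of
`|Q| ℓ(Q) ^ (-d (1 / p + 1 / r))`, which converges because `1 / p + 1 / r > 1`. -/
theorem exists_maximalForm_le_of_separated (hd : 0 < d) {p r γ : ℝ} (hp : 0 < p) (hr : 0 < r)
    (hpr : 1 < 1 / p + 1 / r) (hγ : 0 < γ) :
    ∃ c : ℝ, 0 < c ∧ ∀ {B C : Type*} [NormedAddCommGroup B] [NormedAddCommGroup C] (L : Set (Cube d))
      (f₁ : Rd d → B) (f₂ : Rd d → C) (U V : Set (Rd d)) (x₀ : Rd d) (ρ : ℝ), 0 < ρ →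
      (∀ᵐ x ∂(volume : Measure (Rd d)), x ∉ U → f₁ x = 0) → (∀ x, x ∉ V → f₂ x = 0) →
      U ⊆ Metric.closedBall x₀ ρ → (∀ x ∈ U, ∀ y ∈ V, ρ ≤ dist x y) →
      maximalForm L γ p r f₁ f₂ ≤ ENNReal.ofReal (c * ρ ^ (d - d * (1 / p + 1 / r))) *
        ((∫⁻ x, ‖f₁ x‖ₑ ^ p) ^ (1 / p) * (∫⁻ x, ‖f₂ x‖ₑ ^ r) ^ (1 / r)) := by
  set a : ℝ := d * (1 / p + 1 / r) with ha
  have hd' : (0 : ℝ) < d := by exact_mod_cast hd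
  have had : (d : ℝ) < a := by rw [ha]; nlinarith
  have ha0 : 0 < a := hd'.trans had
  have hP : (d : ℝ) / a < 1 := (div_lt_one ha0).2 had
  have hκ : 0 < √(d : ℝ) := Real.sqrt_pos.2 hd'
  set v : ℝ := (volume (Metric.closedBall (0 : Rd d) 1)).toReal with hv
  have hv0 : 0 < v := ENNReal.toReal_pos
    (Metric.measure_closedBall_pos volume _ one_pos).ne' measure_closedBall_lt_top.ne
  refine ⟨γ⁻¹ * (2 * √d) ^ d * v * ((√d) ^ (a - d) / (1 - d / a)), ?_, ?_⟩
  · have : 0 < 1 - d / a := by linarith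
    positivity
  intro B C _ _ L f₁ f₂ U V x₀ ρ hρ hf₁ hf₂ hU hUV
  refine iSup_le fun S => iSup₂_le fun _ hS => sparseForm_le fun A hA => ?_
  classical
  set F₁ := (∫⁻ x, ‖f₁ x‖ₑ ^ p) ^ (1 / p)
  set F₂ := (∫⁻ x, ‖f₂ x‖ₑ ^ r) ^ (1 / r)
  let G := A.filter fun Q => (Q.toSet ∩ U).Nonempty ∧ (Q.toSet ∩ V).Nonempty
  let b : Cube d → ℝ≥0∞ := fun Q => ENNReal.ofReal (Q.side ^ (-a))
  have hterm : ∑ Q ∈ A, volume Q.toSet * cubeAvg p Q f₁ * cubeAvg r Q f₂ ≤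
      (∑ Q ∈ G, volume Q.toSet * b Q) * (F₁ * F₂) := by
    rw [Finset.sum_mul, Finset.sum_filter]
    refine Finset.sum_le_sum fun Q _ => ?_
    split_ifs with hQ
    · have : b Q = ENNReal.ofReal (Q.side ^ (-(d : ℝ) / p)) * ENNReal.ofReal (Q.side ^ (-(d : ℝ) / r)) := by
        have hs := Q.side_pos
        rw [← ENNReal.ofReal_mul (by positivity), ← Real.rpow_add hs]
        simp only [b, ha]
        congr 2
        ring
      rw [this]
      refine (mul_le_mul' (mul_le_mul_right (cubeAvg_le hp Q f₁) _) (cubeAvg_le hr Q f₂)).trans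
        (le_of_eq ?_)
      ring
    · rw [not_and_or, not_nonempty_iff_eq_empty, not_nonempty_iff_eq_empty,
        ← disjoint_iff_inter_eq_empty, ← disjoint_iff_inter_eq_empty] at hQ
      rcases hQ with hQ | hQ
      · simp [cubeAvg_eq_zero hp hf₁ hQ]
      · simp [cubeAvg_eq_zero hr (Eventually.of_forall hf₂) hQ]
  have hside : ∀ Q ∈ G, ρ ≤ √d * Q.side := by
    intro Q hQ
    obtain ⟨-, ⟨x, hxQ, hx⟩, ⟨y, hyQ, hy⟩⟩ := Finset.mem_filter.1 hQ
    exact (hUV x hx y hy).trans (Cube.dist_le hxQ hyQ)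
  have hball : ∀ Q ∈ G, Q.toSet ⊆ Metric.closedBall x₀ (2 * √d * Q.side) := by
    intro Q hQ z hz
    have h1 := hside Q hQ
    obtain ⟨-, ⟨x, hxQ, hx⟩, -⟩ := Finset.mem_filter.1 hQ
    rw [Metric.mem_closedBall]
    have h2 := Cube.dist_le hz hxQ
    have h3 := Metric.mem_closedBall.1 (hU hx)
    linarith [dist_triangle z x x₀]
  have hmain : ∑ Q ∈ G, volume Q.toSet * b Q ≤
      (ENNReal.ofReal γ)⁻¹ * ENNReal.ofReal ((2 * √d) ^ d) * ENNReal.ofReal v *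
        ENNReal.ofReal (((ρ / √d) ^ (-a)) ^ (1 - d / a) / (1 - d / a)) := by
    refine sum_mul_le_of_bounded G _ b hP (by positivity) (fun Q hQ => ?_) fun t ht => ?_
    · refine ENNReal.ofReal_le_ofReal ?_
      refine Real.rpow_le_rpow_of_nonpos (by positivity) ?_ (by linarith)
      rw [div_le_iff₀ hκ, mul_comm]
      exact hside Q hQ
    · have hR : 0 < 2 * √d * t ^ (-a⁻¹) := by positivity
      refine (hS.sum_volume_le hγ _ fun Q hQ =>
        hA Q (Finset.mem_filter.1 (Finset.mem_filter.1 hQ).1).1).trans ?_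
      rw [mul_assoc, mul_assoc]
      gcongr
      have hsub : ⋃ Q ∈ G.filter (fun Q => ENNReal.ofReal t < b Q), Q.toSet ⊆
          Metric.closedBall x₀ (2 * √d * t ^ (-a⁻¹)) := by
        refine iUnion₂_subset fun Q hQ => (hball Q (Finset.mem_filter.1 hQ).1).trans
          (Metric.closedBall_subset_closedBall ?_)
        have h1 := (Finset.mem_filter.1 hQ).2
        have hs := Q.side_pos
        rw [ENNReal.ofReal_lt_ofReal_iff (by positivity)] at h1
        gcongr
        calc Q.side = (Q.side ^ (-a)) ^ (-a⁻¹) := by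
              rw [← Real.rpow_mul hs.le, neg_mul_neg, mul_inv_cancel₀ ha0.ne', Real.rpow_one]
          _ ≤ t ^ (-a⁻¹) := Real.rpow_le_rpow_of_nonpos ht h1.le (by simpa using ha0.le)
      refine (measure_mono hsub).trans (le_of_eq ?_)
      rw [Measure.addHaar_closedBall' volume _ hR.le, finrank_euclideanSpace_fin, hv,
        ENNReal.ofReal_toReal measure_closedBall_lt_top.ne, mul_pow (2 * √(d : ℝ)),
        ENNReal.ofReal_mul (by positivity), ← Real.rpow_natCast (t ^ (-a⁻¹)), ← Real.rpow_mul ht.le]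
      have : -a⁻¹ * (d : ℝ) = -(d / a) := by ring
      rw [this]
      ring
  refine hterm.trans (mul_le_mul_left (hmain.trans (le_of_eq ?_)) _)
  have e1 : ((ρ / √d) ^ (-a)) ^ (1 - d / a) = (√d) ^ (a - d) * ρ ^ (d - a) := by
    rw [← Real.rpow_mul (by positivity), Real.div_rpow hρ.le hκ.le]
    have e : -a * (1 - d / a) = d - a := by field_simp; ring
    rw [e, div_eq_mul_inv, ← Real.rpow_neg hκ.le, neg_sub, mul_comm]
  have h1 : 0 < 1 - d / a := by linarith
  rw [e1, ← ENNReal.ofReal_inv_of_pos hγ, ← ENNReal.ofReal_mul (by positivity),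
    ← ENNReal.ofReal_mul (by positivity), ← ENNReal.ofReal_mul (by positivity)]
  congr 1
  ring

end Separated

/-! ### Dilations -/

section Dilation

variable {d : ℕ} {𝕜 : Type*} [RCLike 𝕜]
  {B₁ : Type*} [NormedAddCommGroup B₁] [NormedSpace 𝕜 B₁]
  {B₂ : Type*} [NormedAddCommGroup B₂] [NormedSpace 𝕜 B₂]

theorem lintegral_comp_smul {t : ℝ} (ht : 0 < t) (h : Rd d → ℝ≥0∞) :
    ∫⁻ x, h (t • x) = ENNReal.ofReal ((t ^ d)⁻¹) * ∫⁻ x, h x := by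
  have h1 := lintegral_map_equiv (μ := (volume : Measure (Rd d))) h
    (Homeomorph.smulOfNeZero t ht.ne').toMeasurableEquiv
  have h2 : Measure.map (Homeomorph.smulOfNeZero t ht.ne').toMeasurableEquiv
      (volume : Measure (Rd d)) = ENNReal.ofReal ((t ^ d)⁻¹) • volume := by
    have := Measure.map_addHaar_smul (volume : Measure (Rd d)) ht.ne'
    rw [finrank_euclideanSpace_fin, abs_of_pos (by positivity)] at this
    exact this
  rw [h2, lintegral_smul_measure, smul_eq_mul] at h1
  exact h1.symm

theorem lintegral_rpow_dil {B : Type*} [NormedAddCommGroup B] {t p : ℝ} (ht : 0 < t) (hp : 0 < p)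
    (f : Rd d → B) :
    (∫⁻ x, ‖f (t⁻¹ • x)‖ₑ ^ p) ^ (1 / p) =
      ENNReal.ofReal (t ^ ((d : ℝ) / p)) * (∫⁻ x, ‖f x‖ₑ ^ p) ^ (1 / p) := by
  rw [lintegral_comp_smul (inv_pos.2 ht) fun x => ‖f x‖ₑ ^ p,
    ENNReal.mul_rpow_of_nonneg _ _ (by positivity), inv_pow, inv_inv,
    ENNReal.ofReal_rpow_of_pos (by positivity), ← Real.rpow_natCast, ← Real.rpow_mul ht.le,
    mul_one_div]

theorem IsOp.dilOp {T : simpleSpace d 𝕜 B₁ →ₗ[𝕜] (Rd d → B₂)} (hT : IsOp T) {t : ℝ} (ht : 0 < t) :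
    IsOp (dilOp t ht.ne' T) := by
  intro f l
  rw [locallyIntegrable_iff]
  intro K hK
  have hK' : IsCompact ((t • ·) '' K) := hK.image (continuous_const_smul t)
  have h1 := ((hT (dilSimple t⁻¹ (inv_ne_zero ht.ne') f) l).integrableOn_isCompact hK').integrable_indicator
    hK'.measurableSet
  have h2 := (h1.comp_smul ht.ne').integrableOn (s := K)
  refine h2.congr_fun (fun x hx => ?_) hK.measurableSet
  simp only
  rw [indicator_of_mem (mem_image_of_mem _ hx)]
  rfl

theorem enorm_pairing_dilOp (T : simpleSpace d 𝕜 B₁ →ₗ[𝕜] (Rd d → B₂)) {t : ℝ} (ht : 0 < t)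
    (f : simpleSpace d 𝕜 B₁) (f₂ : simpleSpace d 𝕜 (StrongDual 𝕜 B₂)) :
    ‖pairing (dilOp t ht.ne' T f) f₂.1‖ₑ = ENNReal.ofReal (t ^ (-(d : ℝ))) *
      ‖pairing (T (dilSimple t⁻¹ (inv_ne_zero ht.ne') f))
        (dilSimple t⁻¹ (inv_ne_zero ht.ne') f₂).1‖ₑ := by
  set f' := dilSimple t⁻¹ (inv_ne_zero ht.ne') f
  have h := Measure.integral_comp_smul (volume : Measure (Rd d))
    (fun y => f₂.1 (t⁻¹ • y) (T f' y)) t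
  have h1 : pairing (dilOp t ht.ne' T f) f₂.1 =
      ∫ x, (fun y => f₂.1 (t⁻¹ • y) (T f' y)) (t • x) := by
    refine integral_congr_ae (Eventually.of_forall fun x => ?_)
    simp only
    rw [inv_smul_smul₀ ht.ne']
    rfl
  rw [h1, h, enorm_smul, finrank_euclideanSpace_fin, Real.enorm_of_nonneg (by positivity),
    abs_of_pos (by positivity), Real.rpow_neg ht.le, Real.rpow_natCast]
  rfl

/-- Rescaled form of the bound for separated supports; all powers of `t` cancel. -/
theorem exists_enorm_pairing_dilOp_le (hd : 0 < d) {p r γ : ℝ} (hp : 0 < p) (hr : 0 < r)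
    (hpr : 1 < 1 / p + 1 / r) (hγ : 0 < γ) {δ : ℝ} (hδ : 0 < δ) :
    ∃ c : ℝ, 0 < c ∧ ∀ {𝕜 : Type*} [RCLike 𝕜] {B₁ : Type*} [NormedAddCommGroup B₁] [NormedSpace 𝕜 B₁]
      {B₂ : Type*} [NormedAddCommGroup B₂] [NormedSpace 𝕜 B₂] (L : Set (Cube d)) (C : ℝ)
      (T : simpleSpace d 𝕜 B₁ →ₗ[𝕜] (Rd d → B₂)) (t : ℝ) (ht : 0 < t), 0 ≤ C →
      SparseBound L γ p r C T →
      ∀ (f : simpleSpace d 𝕜 B₁) (f₂ : simpleSpace d 𝕜 (StrongDual 𝕜 B₂)) (U V : Set (Rd d)) (x₀ : Rd d),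
      (∀ᵐ x ∂(volume : Measure (Rd d)), x ∉ U → f.1 x = 0) → (∀ x, x ∉ V → f₂.1 x = 0) →
      U ⊆ Metric.closedBall x₀ δ → (∀ x ∈ U, ∀ y ∈ V, δ ≤ dist x y) →
      ‖pairing (dilOp t ht.ne' T f) f₂.1‖ₑ ≤ ENNReal.ofReal (C * c) *
        ((∫⁻ x, ‖f.1 x‖ₑ ^ p) ^ (1 / p) * (∫⁻ x, ‖f₂.1 x‖ₑ ^ r) ^ (1 / r)) := by
  obtain ⟨c, hc, hform⟩ := exists_maximalForm_le_of_separated hd hp hr hpr hγ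
  refine ⟨c * δ ^ (d - d * (1 / p + 1 / r)), by positivity, ?_⟩
  intro 𝕜 _ B₁ _ _ B₂ _ _ L C T t ht hC hT f f₂ U V x₀ hf hf₂ hU hUV
  have hdist : ∀ x y : Rd d, dist x y = t * dist (t⁻¹ • x) (t⁻¹ • y) := by
    intro x y
    rw [dist_smul₀, Real.norm_of_nonneg (by positivity), ← mul_assoc, mul_inv_cancel₀ ht.ne', one_mul]
  have h1 := hform L (dilSimple t⁻¹ (inv_ne_zero ht.ne') f).1
    (dilSimple t⁻¹ (inv_ne_zero ht.ne') f₂).1 ((t⁻¹ • ·) ⁻¹' U) ((t⁻¹ • ·) ⁻¹' V) (t • x₀) (t * δ)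
    (by positivity)
    ((Measure.quasiMeasurePreserving_smul volume (inv_ne_zero ht.ne')).ae hf)
    (fun x hx => hf₂ _ hx)
    (fun x hx => by
      rw [Metric.mem_closedBall, hdist, inv_smul_smul₀ ht.ne']
      exact mul_le_mul_of_nonneg_left (hU hx) ht.le)
    (fun x hx y hy => by
      rw [hdist x y]
      exact mul_le_mul_of_nonneg_left (hUV _ hx _ hy) ht.le)
  have e1 : (∫⁻ x, ‖(dilSimple t⁻¹ (inv_ne_zero ht.ne') f).1 x‖ₑ ^ p) ^ (1 / p) =
      ENNReal.ofReal (t ^ ((d : ℝ) / p)) * (∫⁻ x, ‖f.1 x‖ₑ ^ p) ^ (1 / p) :=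
    lintegral_rpow_dil ht hp f.1
  have e2 : (∫⁻ x, ‖(dilSimple t⁻¹ (inv_ne_zero ht.ne') f₂).1 x‖ₑ ^ r) ^ (1 / r) =
      ENNReal.ofReal (t ^ ((d : ℝ) / r)) * (∫⁻ x, ‖f₂.1 x‖ₑ ^ r) ^ (1 / r) :=
    lintegral_rpow_dil ht hr f₂.1
  rw [e1, e2] at h1
  rw [enorm_pairing_dilOp T ht f f₂]
  have h2 := (hT (dilSimple t⁻¹ (inv_ne_zero ht.ne') f) (dilSimple t⁻¹ (inv_ne_zero ht.ne') f₂)).trans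
    (mul_le_mul_right h1 _)
  refine (mul_le_mul_right h2 _).trans (le_of_eq ?_)
  set F₁ := (∫⁻ x, ‖f.1 x‖ₑ ^ p) ^ (1 / p)
  set F₂ := (∫⁻ x, ‖f₂.1 x‖ₑ ^ r) ^ (1 / r)
  have e3 : C * (c * δ ^ (d - d * (1 / p + 1 / r))) =
      t ^ (-(d : ℝ)) * (C * ((c * (t * δ) ^ (d - d * (1 / p + 1 / r))) *
        (t ^ ((d : ℝ) / p) * t ^ ((d : ℝ) / r)))) := by
    have e4 := Real.mul_rpow (z := d - d * (1 / p + 1 / r)) ht.le hδ.le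
    have : t ^ (-(d : ℝ)) * (t ^ (d - d * (1 / p + 1 / r)) * (t ^ ((d : ℝ) / p) * t ^ ((d : ℝ) / r))) = 1 := by
      rw [← Real.rpow_add ht, ← Real.rpow_add ht, ← Real.rpow_add ht]
      have : -(d : ℝ) + (d - d * (1 / p + 1 / r) + (d / p + d / r)) = 0 := by ring
      rw [this, Real.rpow_zero]
    calc C * (c * δ ^ (d - d * (1 / p + 1 / r)))
        = C * (c * δ ^ (d - d * (1 / p + 1 / r))) * (t ^ (-(d : ℝ)) *
          (t ^ (d - d * (1 / p + 1 / r)) * (t ^ ((d : ℝ) / p) * t ^ ((d : ℝ) / r)))) := by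
          rw [this, mul_one]
      _ = _ := by
        rw [e4]
        generalize d - d * (1 / p + 1 / r) = s
        ring
  rw [e3, ENNReal.ofReal_mul (p := t ^ (-(d : ℝ))) (by positivity), ENNReal.ofReal_mul hC,
    ENNReal.ofReal_mul (p := c * _) (by positivity),
    ENNReal.ofReal_mul (p := t ^ ((d : ℝ) / p)) (by positivity)]
  ring

end Dilation

/-! ### Supports -/

section Support

variable {d : ℕ} {𝕜 : Type*} [RCLike 𝕜] {B : Type*} [NormedAddCommGroup B] [NormedSpace 𝕜 B]

/-- Almost every point has the property `P` if `P` holds almost everywhere in some neighbourhood of it. -/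
theorem ae_of_locally {P : Rd d → Prop} :
    ∀ᵐ x ∂(volume : Measure (Rd d)),
      (∃ U ∈ 𝓝 x, ∀ᵐ y ∂(volume : Measure (Rd d)), y ∈ U → P y) → P x := by
  rw [ae_iff]
  refine measure_null_of_locally_null _ fun x hx => ?_
  simp only [mem_ofPred_eq, Classical.not_imp] at hx
  obtain ⟨⟨U, hU, hP⟩, -⟩ := hx
  refine ⟨U ∩ {y | ¬ P y}, ?_, ?_⟩
  · rw [mem_nhdsWithin_iff_exists_mem_nhds_inter]
    refine ⟨U, hU, fun y hy => ⟨hy.1, ?_⟩⟩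
    have := hy.2
    simp only [mem_ofPred_eq, Classical.not_imp] at this
    exact this.2
  · rw [ae_iff] at hP
    refine measure_mono_null (fun y hy => ?_) hP
    simp only [mem_ofPred_eq, Classical.not_imp]
    exact hy

theorem ae_eq_zero_of_notMem_essSupport (f : Rd d → B) :
    ∀ᵐ x ∂(volume : Measure (Rd d)), x ∉ essSupport f → f x = 0 := by
  filter_upwards [ae_of_locally (P := fun y => f y = 0)] with x hx hxs
  by_contra h0
  exact hxs fun U hU h => h0 (hx ⟨U, hU, h⟩)

theorem ae_eq_zero_of_notMem_weakSupport (F : Rd d → B) (l : StrongDual 𝕜 B) :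
    ∀ᵐ x ∂(volume : Measure (Rd d)), x ∉ weakSupport 𝕜 F → l (F x) = 0 := by
  filter_upwards [ae_of_locally (P := fun y => l (F y) = 0)] with x hx hxs
  by_contra h0
  exact hxs fun U hU h => h0 (hx ⟨U, hU, h l⟩)

theorem essSupport_indicator_subset (s : Set (Rd d)) (f : Rd d → B) :
    essSupport (s.indicator f) ⊆ closure s := by
  intro x hx
  by_contra hxs
  refine hx (closure s)ᶜ (isClosed_closure.isOpen_compl.mem_nhds hxs) (Eventually.of_forall fun y hy => ?_)
  exact indicator_of_notMem (fun h => hy (subset_closure h)) _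

/-- The pairing only sees a test function on the weak support. -/
theorem pairing_indicator (F : Rd d → B) (f₂ : simpleSpace d 𝕜 (StrongDual 𝕜 B)) {N : Set (Rd d)}
    (hN : weakSupport 𝕜 F ⊆ N) : pairing F (N.indicator f₂.1) = pairing F f₂.1 := by
  have h : ∀ᵐ x ∂(volume : Measure (Rd d)), ∀ l ∈ range f₂.1, x ∉ weakSupport 𝕜 F → l (F x) = 0 :=
    (ae_ball_iff f₂.2.1.countable).2 fun l _ => ae_eq_zero_of_notMem_weakSupport F l
  refine integral_congr_ae ?_
  filter_upwards [h] with x hx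
  by_cases hxN : x ∈ N
  · simp only [indicator_of_mem hxN]
  · simp only [indicator_of_notMem hxN]
    rw [hx _ ⟨x, rfl⟩ fun h => hxN (hN h)]
    rfl

end Support

/-! ### Grid cells -/

section Grid

variable {d : ℕ}

/-- The half-open cells of side length `η` of the grid `η ℤ^d`. -/
def gridCell (η : ℝ) (n : Fin d → ℤ) : Set (Rd d) := {x | ∀ i, ⌊x i / η⌋ = n i}

theorem measurableSet_gridCell (η : ℝ) (n : Fin d → ℤ) : MeasurableSet (gridCell η n) := by
  have : gridCell η n = ⋂ i, {x : Rd d | ⌊x i / η⌋ = n i} := by ext x; simp [gridCell]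
  rw [this]
  refine MeasurableSet.iInter fun i => ?_
  have h : Measurable fun x : Rd d => ⌊x i / η⌋ :=
    Int.measurable_floor.comp
      ((EuclideanSpace.proj (𝕜 := ℝ) i).continuous.measurable.div_const η)
  exact h (measurableSet_singleton (n i))

theorem ediam_gridCell_le {η : ℝ} (hη : 0 < η) (n : Fin d → ℤ) :
    Metric.ediam (gridCell η n) ≤ ENNReal.ofReal (√d * η) := by
  refine Metric.ediam_le fun x hx y hy => ?_
  rw [edist_dist]
  refine ENNReal.ofReal_le_ofReal (dist_le_of_coord hη.le fun i => ?_)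
  have h1 := hx i
  have h2 := hy i
  rw [Int.floor_eq_iff, le_div_iff₀ hη, div_lt_iff₀ hη] at h1 h2
  rw [abs_le]
  constructor <;> nlinarith

theorem abs_coord_sub_le (x y : Rd d) (i : Fin d) : |x i - y i| ≤ dist x y := by
  rw [dist_eq_norm]
  exact PiLp.norm_apply_le (x - y) i

/-- The cells met by a ball have index in a box, whose size is bounded in `card_grid_le`. -/
theorem mem_Icc_of_dist_le {η : ℝ} (hη : 0 < η) {n : Fin d → ℤ} {x z : Rd d} {R : ℝ}
    (hz : z ∈ gridCell η n) (h : dist x z ≤ R) :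
    n ∈ Finset.Icc (fun i => ⌊(x i - R) / η⌋) (fun i => ⌊(x i + R) / η⌋) := by
  rw [Finset.mem_Icc]
  constructor <;> intro i <;> rw [← hz i] <;> refine Int.floor_le_floor (div_le_div_of_nonneg_right ?_ hη.le)
  all_goals
    have := abs_le.1 ((abs_coord_sub_le x z i).trans h)
    linarith

theorem card_grid_le (η : ℝ) (x : Rd d) (R : ℝ) :
    (Finset.Icc (fun i => ⌊(x i - R) / η⌋) (fun i => ⌊(x i + R) / η⌋)).card ≤ ⌈2 * R / η + 2⌉₊ ^ d := by
  rw [Pi.card_Icc]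
  refine (Finset.prod_le_pow_card _ _ ⌈2 * R / η + 2⌉₊ fun i _ => ?_).trans (by simp)
  rw [Int.card_Icc, Int.toNat_le]
  have h1 := Int.floor_le ((x i + R) / η)
  have h2 := Int.lt_floor_add_one ((x i - R) / η)
  have h3 := Nat.le_ceil (2 * R / η + 2)
  have h4 : (x i + R) / η - (x i - R) / η = 2 * R / η := by ring
  have : ((⌊(x i + R) / η⌋ + 1 - ⌊(x i - R) / η⌋ : ℤ) : ℝ) ≤ ((⌈2 * R / η + 2⌉₊ : ℤ) : ℝ) := by
    push_cast
    linarith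
  exact_mod_cast this

end Grid

/-! ### Single-scale bounds -/

section SingleScale

theorem sum_rpow_le_rpow_sum {ι : Type*} (s : Finset ι) (a : ι → ℝ≥0∞) {z : ℝ} (hz : 1 ≤ z) :
    ∑ i ∈ s, a i ^ z ≤ (∑ i ∈ s, a i) ^ z := by
  classical
  induction s using Finset.induction_on with
  | empty => simp
  | insert i s hi ih =>
    rw [Finset.sum_insert hi, Finset.sum_insert hi]
    exact (add_le_add le_rfl ih).trans (ENNReal.add_rpow_le_rpow_add _ _ hz)

variable {d : ℕ}

theorem holderConjugate_div_sub_one {q : ℝ} (hq : 1 < q) : q.HolderConjugate (q / (q - 1)) :=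
  Real.HolderConjugate.conjExponent hq

/-- The improving bound for a single operator, in dual form. The function `f` is cut into pieces `f_n`
supported in cells of diameter at most `δ₂`; the strengthened support condition allows `f₂` to be
restricted to the points at distance between `δ₁` and `1` from the support of `f_n`, so that the bound
for separated supports applies. The sum over `n` is estimated by Hölder's inequality, the embedding
of `ℓ^p` into `ℓ^q` and the bounded overlap of the restrictions of `f₂`. -/
theorem exists_enorm_pairing_dilOp_le_of_strengthened (hd : 0 < d) {p q γ δ₁ δ₂ : ℝ} (hp : 1 < p)
    (hpq : p < q) (hγ : 0 < γ) (hδ₂ : 0 < δ₂) (hδ : δ₂ < δ₁) :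
    ∃ c : ℝ, 0 < c ∧ ∀ {𝕜 : Type*} [RCLike 𝕜] {B₁ : Type*} [NormedAddCommGroup B₁] [NormedSpace 𝕜 B₁]
      {B₂ : Type*} [NormedAddCommGroup B₂] [NormedSpace 𝕜 B₂] (L : Set (Cube d)) (C : ℝ)
      (T : simpleSpace d 𝕜 B₁ →ₗ[𝕜] (Rd d → B₂)) (t : ℝ) (ht : 0 < t), 0 ≤ C → IsOp T →
      SparseBound L γ p (q / (q - 1)) C T →
      (∀ f : simpleSpace d 𝕜 B₁, Metric.ediam (essSupport f.1) ≤ ENNReal.ofReal δ₂ →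
        weakSupport 𝕜 (dilOp t ht.ne' T f) ⊆
          {x | ENNReal.ofReal δ₁ ≤ Metric.infEDist x (essSupport f.1) ∧
            Metric.infEDist x (essSupport f.1) ≤ 1}) →
      ∀ (f : simpleSpace d 𝕜 B₁) (f₂ : simpleSpace d 𝕜 (StrongDual 𝕜 B₂)),
      ‖pairing (dilOp t ht.ne' T f) f₂.1‖ₑ ≤ ENNReal.ofReal (c * C) *
        (∫⁻ x, ‖f.1 x‖ₑ ^ p) ^ (1 / p) *
          (∫⁻ x, ‖f₂.1 x‖ₑ ^ (q / (q - 1))) ^ (1 / (q / (q - 1))) := by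
  have hp0 : 0 < p := by linarith
  have hq : 1 < q := hp.trans hpq
  have hq0 : 0 < q := by linarith
  have hq1 : 0 < q - 1 := by linarith
  set r := q / (q - 1) with hr
  have hr0 : 0 < r := by positivity
  have hd' : (0 : ℝ) < d := by exact_mod_cast hd
  have hκ : 0 < √(d : ℝ) := Real.sqrt_pos.2 hd'
  have hpr : 1 < 1 / p + 1 / r := by
    have h1 : 1 / r = 1 - 1 / q := by rw [hr]; field_simp
    have h2 : 1 / q < 1 / p := one_div_lt_one_div_of_lt hp0 hpq
    linarith
  set η := δ₂ / √d with hη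
  have hη0 : 0 < η := by positivity
  obtain ⟨c, hc, hpiece⟩ := exists_enorm_pairing_dilOp_le hd hp0 hr0 hpr hγ (hδ₂.trans hδ)
  set M : ℕ := ⌈2 * 3 / η + 2⌉₊ ^ d with hM
  have hM0 : 0 < M := pow_pos (Nat.ceil_pos.2 (by positivity)) d
  refine ⟨c * (M : ℝ) ^ (1 / r), by positivity, ?_⟩
  intro 𝕜 _ B₁ _ _ B₂ _ _ L C T t ht hC hop hT hsupp f f₂
  -- Pieces of `f` and the sets that carry the images of the pieces.
  let fn : (Fin d → ℤ) → simpleSpace d 𝕜 B₁ := fun n => ⟨(gridCell η n).indicator f.1,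
    indicator_mem_simpleSpace f.2 (measurableSet_gridCell η n).nullMeasurableSet⟩
  let N : (Fin d → ℤ) → Set (Rd d) := fun n => {x | ENNReal.ofReal δ₁ ≤ Metric.infEDist x (essSupport (fn n).1) ∧
            Metric.infEDist x (essSupport (fn n).1) ≤ 1}
  have hNm : ∀ n, MeasurableSet (N n) := fun n =>
    (measurableSet_le measurable_const measurable_infEDist).inter
      (measurableSet_le measurable_infEDist measurable_const)
  let gn : (Fin d → ℤ) → simpleSpace d 𝕜 (StrongDual 𝕜 B₂) := fun n => ⟨(N n).indicator f₂.1,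
    indicator_mem_simpleSpace f₂.2 (hNm n).nullMeasurableSet⟩
  have hdiam : ∀ n, Metric.ediam (essSupport (fn n).1) ≤ ENNReal.ofReal δ₂ := by
    intro n
    refine (Metric.ediam_mono (essSupport_indicator_subset _ _)).trans ?_
    rw [Metric.ediam_closure]
    refine (ediam_gridCell_le hη0 n).trans (le_of_eq ?_)
    rw [hη, mul_div_cancel₀ _ hκ.ne']
  have hpn : ∀ n, ‖pairing (dilOp t ht.ne' T (fn n)) f₂.1‖ₑ ≤ ENNReal.ofReal (C * c) *
      ((∫⁻ x, ‖(fn n).1 x‖ₑ ^ p) ^ (1 / p) * (∫⁻ x, ‖(gn n).1 x‖ₑ ^ r) ^ (1 / r)) := by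
    intro n
    rw [← pairing_indicator _ f₂ (hsupp (fn n) (hdiam n))]
    obtain ⟨x₀, hx₀⟩ : ∃ x₀, essSupport (fn n).1 ⊆ Metric.closedBall x₀ δ₁ := by
      rcases (essSupport (fn n).1).eq_empty_or_nonempty with h | ⟨x₀, hx₀⟩
      · exact ⟨0, by rw [h]; exact empty_subset _⟩
      · refine ⟨x₀, fun y hy => ?_⟩
        have := (Metric.edist_le_ediam_of_mem hy hx₀).trans (hdiam n)
        rw [edist_dist, ENNReal.ofReal_le_ofReal_iff hδ₂.le] at this
        exact this.trans hδ.le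
    refine hpiece L C T t ht hC hT (fn n) (gn n) (essSupport (fn n).1) (N n) x₀
      (ae_eq_zero_of_notMem_essSupport _) (fun x hx => indicator_of_notMem hx _) hx₀ ?_
    intro x hx y hy
    have := hy.1.trans (Metric.infEDist_le_edist_of_mem hx)
    rw [edist_dist, ENNReal.ofReal_le_ofReal_iff dist_nonneg, dist_comm] at this
    exact this
  -- Only finitely many pieces are nonzero.
  obtain ⟨R, hR⟩ : ∃ R : ℝ, tsupport f.1 ⊆ Metric.closedBall 0 R :=
    (IsCompact.isBounded f.2.2.2).subset_closedBall 0
  let s : Finset (Fin d → ℤ) := Finset.Icc (fun _ => ⌊(0 - R) / η⌋) (fun _ => ⌊(0 + R) / η⌋)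
  have hs : ∀ x, f.1 x ≠ 0 → (fun i => ⌊x i / η⌋) ∈ s := by
    intro x hx
    have := hR (subset_tsupport _ hx)
    rw [Metric.mem_closedBall, dist_comm] at this
    simpa [s] using mem_Icc_of_dist_le hη0 (n := fun i => ⌊x i / η⌋) (fun i => rfl) this
  have hcell : ∀ (x : Rd d) (n : Fin d → ℤ), x ∈ gridCell η n ↔ n = (fun i => ⌊x i / η⌋) := fun x n =>
    ⟨fun h => funext fun i => (h i).symm, fun h i => (congrFun h i).symm⟩
  have hsum : f = ∑ n ∈ s, fn n := by
    apply Subtype.ext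
    ext x
    simp only [Submodule.coe_sum, Finset.sum_apply, fn]
    by_cases hx : f.1 x = 0
    · rw [hx, Finset.sum_eq_zero]
      intro n _
      by_cases h : x ∈ gridCell η n <;> simp [h, hx]
    · rw [Finset.sum_eq_single (fun i => ⌊x i / η⌋)]
      · rw [indicator_of_mem ((hcell _ _).2 rfl)]
      · intro n _ hn
        exact indicator_of_notMem (fun h => hn ((hcell _ _).1 h)) _
      · intro h
        exact absurd (hs x hx) h
  have hpair : pairing (dilOp t ht.ne' T f) f₂.1 = ∑ n ∈ s, pairing (dilOp t ht.ne' T (fn n)) f₂.1 := by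
    rw [← pairing_sum s (fun n => dilOp t ht.ne' T (fn n)) (fun n => hop.dilOp ht (fn n)) f₂,
      ← map_sum, ← hsum]
  set F₁ := ∫⁻ x, ‖f.1 x‖ₑ ^ p with hF₁
  set F₂ := ∫⁻ x, ‖f₂.1 x‖ₑ ^ r with hF₂
  have hf₁sum : ∑ n ∈ s, ∫⁻ x, ‖(fn n).1 x‖ₑ ^ p ≤ F₁ := by
    rw [← lintegral_finsetSum' _ fun n _ =>
      (aestronglyMeasurable_of_mem_simpleSpace (fn n).2).enorm.pow_const p]
    refine lintegral_mono fun x => ?_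
    refine (Finset.sum_le_sum_of_ne_zero (t := {fun i => ⌊x i / η⌋}) fun n _ hn => ?_).trans ?_
    · rw [Finset.mem_singleton, ← hcell]
      by_contra h
      exact hn (by simp [fn, h, hp0])
    · rw [Finset.sum_singleton]
      simp only [fn]
      rw [indicator_of_mem ((hcell _ _).2 rfl)]
  have hf₂sum : ∑ n ∈ s, ∫⁻ x, ‖(gn n).1 x‖ₑ ^ r ≤ M * F₂ := by
    rw [← lintegral_finsetSum' _ fun n _ =>
      (aestronglyMeasurable_of_mem_simpleSpace (gn n).2).enorm.pow_const r,
      ← lintegral_const_mul' _ _ (ENNReal.natCast_ne_top M)]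
    refine lintegral_mono fun x => ?_
    refine (Finset.sum_le_sum_of_ne_zero
      (t := Finset.Icc (fun i => ⌊(x i - 3) / η⌋) (fun i => ⌊(x i + 3) / η⌋)) fun n _ hn => ?_).trans ?_
    · have hxN : x ∈ N n := by
        by_contra h
        exact hn (by simp [gn, h, hr0])
      have h1 : Metric.infEDist x (essSupport (fn n).1) < 2 := hxN.2.trans_lt (by norm_num)
      obtain ⟨y, hy, hxy⟩ := Metric.infEDist_lt_iff.1 h1
      obtain ⟨z, hz, hyz⟩ := Metric.mem_closure_iff.1 (essSupport_indicator_subset _ _ hy) 1 one_pos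
      refine mem_Icc_of_dist_le hη0 hz ?_
      have h2 : dist x y < 2 := by
        rw [edist_dist] at hxy
        simpa using (ENNReal.ofReal_lt_iff_lt_toReal dist_nonneg (by simp)).1 hxy
      linarith [dist_triangle x y z]
    · refine (Finset.sum_le_card_nsmul _ _ (‖f₂.1 x‖ₑ ^ r) fun n _ => ?_).trans ?_
      · refine ENNReal.rpow_le_rpow ?_ hr0.le
        by_cases h : x ∈ N n
        · simp only [gn]
          rw [indicator_of_mem h]
        · simp only [gn]
          rw [indicator_of_notMem h]
          exact (enorm_zero (E := StrongDual 𝕜 B₂)).trans_le zero_le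
      · rw [nsmul_eq_mul]
        gcongr
        exact card_grid_le η x 3
  calc ‖pairing (dilOp t ht.ne' T f) f₂.1‖ₑ
      ≤ ∑ n ∈ s, ‖pairing (dilOp t ht.ne' T (fn n)) f₂.1‖ₑ := by
        rw [hpair]; exact enorm_sum_le _ _
    _ ≤ ∑ n ∈ s, ENNReal.ofReal (C * c) *
      ((∫⁻ x, ‖(fn n).1 x‖ₑ ^ p) ^ (1 / p) * (∫⁻ x, ‖(gn n).1 x‖ₑ ^ r) ^ (1 / r)) :=
        Finset.sum_le_sum fun n _ => hpn n
    _ ≤ ENNReal.ofReal (C * c) *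
        ((∑ n ∈ s, ((∫⁻ x, ‖(fn n).1 x‖ₑ ^ p) ^ (1 / p)) ^ q) ^ (1 / q) *
          (∑ n ∈ s, ((∫⁻ x, ‖(gn n).1 x‖ₑ ^ r) ^ (1 / r)) ^ r) ^ (1 / r)) := by
        rw [← Finset.mul_sum]
        gcongr
        exact ENNReal.inner_le_Lp_mul_Lq s _ _ (holderConjugate_div_sub_one hq)
    _ ≤ ENNReal.ofReal (C * c) * (F₁ ^ (1 / p) * (M * F₂) ^ (1 / r)) := by
        gcongr
        · have e1 : ∀ I : ℝ≥0∞, (I ^ (1 / p)) ^ q = I ^ (q / p) := fun I => by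
            rw [← ENNReal.rpow_mul]; congr 1; ring
          simp_rw [e1]
          calc (∑ n ∈ s, (∫⁻ x, ‖(fn n).1 x‖ₑ ^ p) ^ (q / p)) ^ (1 / q)
              ≤ ((∑ n ∈ s, ∫⁻ x, ‖(fn n).1 x‖ₑ ^ p) ^ (q / p)) ^ (1 / q) := by
                refine ENNReal.rpow_le_rpow (sum_rpow_le_rpow_sum _ _ ?_) (by positivity)
                exact ((one_lt_div hp0).2 hpq).le
            _ ≤ (F₁ ^ (q / p)) ^ (1 / q) := by gcongr
            _ = _ := by
                rw [← ENNReal.rpow_mul]; congr 1; field_simp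
        · refine le_trans (le_of_eq ?_) hf₂sum
          refine Finset.sum_congr rfl fun n _ => ?_
          rw [← ENNReal.rpow_mul, one_div_mul_cancel hr0.ne', ENNReal.rpow_one]
    _ = _ := by
        have e2 : c * (M : ℝ) ^ (1 / r) * C = C * c * (M : ℝ) ^ (1 / r) := by ring
        have hCc : 0 ≤ C * c := by positivity
        rw [ENNReal.mul_rpow_of_nonneg _ _ (by positivity), e2, ENNReal.ofReal_mul hCc,
          ← ENNReal.ofReal_rpow_of_nonneg (Nat.cast_nonneg M) (by positivity), ENNReal.ofReal_natCast]
        ring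

/-- The bound `L^p → L^q` for a single rescaled operator, with a constant independent of the scale `t`. -/
theorem exists_opNormLE_dilOp (hd : 0 < d) {p q γ δ₁ δ₂ : ℝ} (hp : 1 < p)
    (hpq : p < q) (hγ : 0 < γ) (hδ₂ : 0 < δ₂) (hδ : δ₂ < δ₁) :
    ∃ c : ℝ, 0 < c ∧ ∀ {𝕜 : Type*} [RCLike 𝕜] {B₁ : Type*} [NormedAddCommGroup B₁] [NormedSpace 𝕜 B₁]
      {B₂ : Type*} [NormedAddCommGroup B₂] [NormedSpace 𝕜 B₂] [CompleteSpace B₂]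
      (L : Set (Cube d)) (C : ℝ)
      (T : simpleSpace d 𝕜 B₁ →ₗ[𝕜] (Rd d → B₂)) (t : ℝ) (ht : 0 < t), 0 ≤ C → IsReflexive 𝕜 B₂ →
      IsOp T → SparseBound L γ p (q / (q - 1)) C T →
      (∀ f : simpleSpace d 𝕜 B₁, Metric.ediam (essSupport f.1) ≤ ENNReal.ofReal δ₂ →
        weakSupport 𝕜 (dilOp t ht.ne' T f) ⊆
          {x | ENNReal.ofReal δ₁ ≤ Metric.infEDist x (essSupport f.1) ∧
            Metric.infEDist x (essSupport f.1) ≤ 1}) →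
      OpNormLE (dilOp t ht.ne' T) (lebesgueNorm p) (lebesgueNorm q) (c * C) := by
  obtain ⟨c, hc, hpair⟩ := exists_enorm_pairing_dilOp_le_of_strengthened hd hp hpq hγ hδ₂ hδ
  refine ⟨c, hc, ?_⟩
  intro 𝕜 _ B₁ _ _ B₂ _ _ _ L C T t ht hC hB hop hT hsupp f
  have hp0 : 0 < p := by linarith
  have hq : 1 < q := hp.trans hpq
  have hq0 : 0 < q := by linarith
  have hq1 : 0 < q - 1 := by linarith
  have hr0 : 0 < q / (q - 1) := by positivity
  have hbound := hpair L C T t ht hC hop hT hsupp f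
  have hmono : ∀ (f₂ : simpleSpace d 𝕜 (StrongDual 𝕜 B₂)) (φ : Rd d → ℝ), (∀ x, ‖f₂.1 x‖ ≤ φ x) →
      ‖pairing (dilOp t ht.ne' T f) f₂.1‖ₑ ≤ ENNReal.ofReal (c * C) *
        (∫⁻ x, ‖f.1 x‖ₑ ^ p) ^ (1 / p) *
          (∫⁻ x, ENNReal.ofReal (φ x) ^ (q / (q - 1))) ^ (1 / (q / (q - 1))) := by
    intro f₂ φ h
    refine (hbound f₂).trans (mul_le_mul_right ?_ _)
    refine ENNReal.rpow_le_rpow (lintegral_mono fun x => ?_) (by positivity)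
    refine ENNReal.rpow_le_rpow ?_ hr0.le
    rw [← ofReal_norm]
    exact ENNReal.ofReal_le_ofReal (h x)
  have hfin : ∀ R : ℝ, ENNReal.ofReal (c * C) * (∫⁻ x, ‖f.1 x‖ₑ ^ p) ^ (1 / p) *
      (∫⁻ x, ENNReal.ofReal ((Metric.closedBall (0 : Rd d) R).indicator 1 x) ^ (q / (q - 1))) ^
        (1 / (q / (q - 1))) ≠ ∞ := by
    intro R
    refine ENNReal.mul_ne_top (ENNReal.mul_ne_top ENNReal.ofReal_ne_top ?_) ?_
    · exact ENNReal.rpow_ne_top_of_nonneg (by positivity)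
        (lintegral_rpow_ne_top_of_mem_simpleSpace f.2 hp0)
    · refine ENNReal.rpow_ne_top_of_nonneg (by positivity) ?_
      refine ne_top_of_le_ne_top (measure_closedBall_lt_top (μ := volume) (x := (0 : Rd d)) (r := R)).ne ?_
      rw [← lintegral_indicator_one measurableSet_closedBall]
      refine lintegral_mono fun x => ?_
      by_cases hx : x ∈ Metric.closedBall (0 : Rd d) R
      · simp only [indicator_of_mem hx]; simp
      · simp only [indicator_of_notMem hx]; simp [hr0]
  obtain ⟨g, hg, hTg, hφ⟩ := exists_strong_representative hB (hop.dilOp ht f) fun R =>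
    ⟨_, hfin R, fun f₂ hf₂ => hmono f₂ _ hf₂⟩
  refine ⟨g, hg, hTg, ?_⟩
  rw [lebesgueNorm_eq hq0, lebesgueNorm_eq hp0]
  exact lintegral_rpow_le_of_simple hq hg.enorm fun φ h0 => hφ φ _ h0 fun f₂ hf₂ => hmono f₂ _ hf₂

end SingleScale

/-! ### Operator norm bounds -/

theorem OpNormLE.mono {d : ℕ} {𝕜 : Type*} [RCLike 𝕜]
    {B₁ : Type*} [NormedAddCommGroup B₁] [NormedSpace 𝕜 B₁]
    {B₂ : Type*} [NormedAddCommGroup B₂] [NormedSpace 𝕜 B₂]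
    {T : simpleSpace d 𝕜 B₁ →ₗ[𝕜] (Rd d → B₂)} {X : (Rd d → B₁) → ℝ≥0∞} {Y : (Rd d → B₂) → ℝ≥0∞}
    {A A' : ℝ} (hT : OpNormLE T X Y A) (h : A ≤ A') : OpNormLE T X Y A' := fun f => by
  obtain ⟨g, hg, hTg, hle⟩ := hT f
  exact ⟨g, hg, hTg, hle.trans (mul_le_mul_left (ENNReal.ofReal_le_ofReal h) _)⟩

end SparseDom

theorem theorem2p5 (d : ℕ) (hd : 0 < d) (p q γ : ℝ) (hp : 1 < p) (hpq : p < q)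
    (hγ₀ : 0 < γ) (hγ₁ : γ < 1) :
    ∃ c : ℝ, 0 < c ∧ ∃ c' : ℝ → ℝ → ℝ, (∀ δ₁ δ₂ : ℝ, 0 < c' δ₁ δ₂) ∧
      ∀ (𝕜 : Type*) [RCLike 𝕜]
        (B₁ : Type*) [NormedAddCommGroup B₁] [NormedSpace 𝕜 B₁] [CompleteSpace B₁]
        (B₂ : Type*) [NormedAddCommGroup B₂] [NormedSpace 𝕜 B₂] [CompleteSpace B₂]
        (L : Set (Cube d)) (T : ℤ → simpleSpace d 𝕜 B₁ →ₗ[𝕜] (Rd d → B₂)) (C : ℝ),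
        IsReflexive 𝕜 B₂ →
        IsDyadicLattice L →
        (∀ j, IsOp (T j)) →
        SupportCondition T →
        0 < C →
        (∀ N₁ N₂ : ℤ, N₁ ≤ N₂ →
          SparseBound L γ p (q / (q - 1)) C (∑ j ∈ Finset.Icc N₁ N₂, T j)) →
        (∀ N₁ N₂ : ℤ, N₁ ≤ N₂ →
          OpNormLE (∑ j ∈ Finset.Icc N₁ N₂, T j) (lebesgueNorm p) (weakLorentzNorm p) (c * C) ∧
          OpNormLE (∑ j ∈ Finset.Icc N₁ N₂, T j) (lorentzOneNorm q) (lebesgueNorm q) (c * C)) ∧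
        (∀ δ₁ δ₂ : ℝ, 0 < δ₂ → δ₂ < δ₁ → StrengthenedSupportCondition δ₁ δ₂ T →
          ∀ j : ℤ,
            OpNormLE (dyadicDil j (T j)) (lebesgueNorm p) (lebesgueNorm q) (c' δ₁ δ₂ * C)) := by
  have hpos₁ : 0 < p / (p - 1) * formConst p (q / (q - 1)) γ :=
    mul_pos (div_pos (by linarith) (by linarith)) (formConst_pos hp hγ₀ (exponent_lt_one hp hpq))
  -- The value of the constant outside the range `0 < δ₂ < δ₁` is irrelevant.
  have hscale : ∀ δ₁ δ₂ : ℝ, ∃ c : ℝ, 0 < c ∧ (0 < δ₂ → δ₂ < δ₁ → _) := fun δ₁ δ₂ => by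
    by_cases h : 0 < δ₂ ∧ δ₂ < δ₁
    · obtain ⟨c, hc, hop⟩ := exists_opNormLE_dilOp hd hp hpq hγ₀ h.1 h.2
      exact ⟨c, hc, fun _ _ => @hop⟩
    · exact ⟨1, one_pos, fun h₂ h₁ => absurd ⟨h₂, h₁⟩ h⟩
  choose c' hc' hop' using hscale
  refine ⟨max (p / (p - 1) * formConst p (q / (q - 1)) γ) (4 * formConst (q / (q - 1)) p γ),
    lt_max_of_lt_left hpos₁, c', hc', ?_⟩
  intro 𝕜 _ B₁ _ _ _ B₂ _ _ _ L T C hB hL hop _ hC hT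
  refine ⟨fun N₁ N₂ hN => ⟨?_, ?_⟩, fun δ₁ δ₂ hδ₂ hδ hsupp j => ?_⟩
  · refine (SparseBound.weakLorentz hB hL hγ₀ hp hpq (IsOp.sum hop _) (hT N₁ N₂ hN) hC).mono ?_
    exact mul_le_mul_of_nonneg_right (le_max_left _ _) hC.le
  · refine (SparseBound.lorentzOne hB hL hγ₀ hp hpq (IsOp.sum hop _) (hT N₁ N₂ hN) hC).mono ?_
    exact mul_le_mul_of_nonneg_right (le_max_right _ _) hC.le
  · have hTj := hT j j le_rfl
    rw [Finset.Icc_self, Finset.sum_singleton] at hTj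
    exact hop' δ₁ δ₂ hδ₂ hδ L C (T j) (2 ^ j) (by positivity) hC.le hB (hop j) hTj (hsupp j)
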